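/- For every $m\ge 1$ let $p_{1,m},\dots,p_{m,m}$ be $[0,1]$-valued random variables ($p$-values) on a probability space $(\Omega_m,\mathcal A_m,P_m)$, and let $\{1,\dots,m\}=I_{0,m}\cup I_{1,m}$ be a nonrandom disjoint decomposition into true and false nulls, with $m_0=\#I_{0,m}$. Assume that $(p_{i,m})_{i\in I_{0,m}}$ are independent and uniformly distributed on $[0,1]$ and that the vector $(p_{i,m})_{i\in I_{0,m}}$ is independent of the vector $(p_{i,m})_{i\in I_{1,m}}$, whose joint distribution is arbitrary. Let $\widehat F_m$ be the empirical distribution function of $p_{1,m},\dots,p_{m,m}$, and put $R_m(t)=m\widehat F_m(t)$. Fix $0<\alpha\le\lambda<1$, and let $\widehat m_0=\widehat m_0((\widehat F_m(t))_{t\ge\lambda})>0$ be an estimator of $m_0$ that is a measurable function of $(\widehat F_m(t))_{t\ge\lambda}$. The adaptive step-up test has critical values $\widehat\alpha_{i:m}=\min\{i\alpha/\widehat m_0,\lambda\}$, $0\le i\le m$. With the ordered $p$-values $p_{1:m}\le\dots\le p_{m:m}$ and $p_{0:m}:=0$, its number of rejections is $R_m=\max\{0\le i\le m: p_{i:m}\le\widehat\alpha_{i:m}\}$.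 It rejects the $i$-th null if and only if $p_{i,m}\le\widehat\alpha_{R_m:m}$, and $V_m=\#\{i\in I_{0,m}:p_{i,m}\le\widehat\alpha_{R_m:m}\}$ is the number of false rejections. We use the convention $0/0=0$. Let $R_m^{(1,\lambda)}$ be the number of rejections of the same test applied to the vector obtained from $(p_{1,m},\dots,p_{m,m})$ by replacing with $0$ the $p$-value $p_{i,m}$ with the smallest index $i\in I_{0,m}$ such that $p_{i,m}\le\lambda$ (no replacement is made if there is no such $i$). Assume (A1) $m_0/m\to\kappa_0$ as $m\to\infty$ for some $\kappa_0\in(0,1]$; (A2) $\frac{\lambda}{\alpha}\widehat m_0\ge R_m(\lambda)$ for all $m\ge 1$; (A3) there is some $K>0$ with $\widehat m_0\le Km$ for all $m\ge 1$. Then the following are equivalent (limits as $m\to\infty$): (a) $\dfrac{V_m}{R_m}-\mathbb E\Bigl(\dfrac{V_m}{R_m}\Bigr)\to 0$ in $P_m$-probability; (b) $\dfrac{\widehat m_0}{m}-\mathbb E\Bigl(\dfrac{\widehat m_0}{m}\Bigr)\to 0$ in $P_m$-probability, and $R_m^{(1,\lambda)}\to\infty$ in $P_m$-probability, i.e. $P_m(R_m^{(1,\lambda)}\le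 C)\to0$ for every $C\in\mathbb R$. -/

import Mathlib

open MeasureTheory ProbabilityTheory Filter Topology

namespace MultipleTesting

noncomputable section

/-- The basic independence model for `m` p-values `p i`, `i : Fin m`, on a probability space, where
`I₀` is the set of true nulls and its complement the set of false nulls. No condition is put on
the joint law of the p-values of the false nulls. -/
structure BasicIndependence {Ω : Type*} [MeasurableSpace Ω] (P : Measure Ω) {m : ℕ}
    (I₀ : Finset (Fin m)) (p : Fin m → Ω → ℝ) : Prop where
  measurable : ∀ i, Measurable (p i)
  mem_Icc : ∀ i ω, p i ω ∈ Set.Icc (0 : ℝ) 1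
  indep_null_alt :
    IndepFun (fun ω (i : {i // i ∈ I₀}) => p i ω) (fun ω (i : {i // i ∉ I₀}) => p i ω) P
  indep_null : iIndepFun (fun (i : {i // i ∈ I₀}) => p i) P
  uniform_null : ∀ i ∈ I₀, ∀ x ∈ Set.Icc (0 : ℝ) 1, P {ω | p i ω ≤ x} = ENNReal.ofReal x

variable {m : ℕ}

/-- Empirical distribution function of `x₁, …, x_m`. -/
def ecdf (x : Fin m → ℝ) (t : ℝ) : ℝ :=
  ((Finset.univ.filter (fun i => x i ≤ t)).card : ℝ) / m

/-- The restriction `(F̂_m(t))_{t ≥ lam}` of the empirical distribution function. -/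
def ecdfTail (lam : ℝ) (x : Fin m → ℝ) : Set.Ici lam → ℝ :=
  fun t => ecdf x t

/-- `R_m(t) = m F̂_m(t)`. -/
def countLE (x : Fin m → ℝ) (t : ℝ) : ℝ := m * ecdf x t

/-- The order statistic `x_{i:m}` for `1 ≤ i ≤ m`, with `x_{0:m} = 0`
(the value `0` for `i > m` is never used). -/
def orderStat (x : Fin m → ℝ) (i : ℕ) : ℝ :=
  if h : 1 ≤ i ∧ i ≤ m then x (Tuple.sort x ⟨i - 1, by omega⟩) else 0

/-- Number of rejections `max {i = 0, …, m : x_{i:m} ≤ c_i}` of the step-up test with critical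
values `c`. -/
def stepUpRejections (c : ℕ → ℝ) (x : Fin m → ℝ) : ℕ :=
  Nat.findGreatest (fun i => orderStat x i ≤ c i) m

/-- Critical values `min {i α / m̂₀, lam}`. -/
def critValue (α lam m0hat : ℝ) (i : ℕ) : ℝ := min (i / m0hat * α) lam

/-- Data-driven critical values of the adaptive test with estimator
`m̂₀ = g ((F̂_m(t))_{t ≥ lam})`. -/
def adaptiveCrit (α lam : ℝ) (g : (Set.Ici lam → ℝ) → ℝ) (x : Fin m → ℝ) : ℕ → ℝ :=
  critValue α lam (g (ecdfTail lam x))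

/-- `R_m`, the number of rejections of the adaptive step-up test. -/
def rejections (α lam : ℝ) (g : (Set.Ici lam → ℝ) → ℝ) (x : Fin m → ℝ) : ℕ :=
  stepUpRejections (adaptiveCrit α lam g x) x

/-- `V_m`, the number of rejected true nulls; hypothesis `i` is rejected iff its p-value is at most
the `R_m`-th critical value. -/
def falseRejections (α lam : ℝ) (g : (Set.Ici lam → ℝ) → ℝ) (I₀ : Finset (Fin m))
    (x : Fin m → ℝ) : ℕ :=
  (I₀.filter (fun i => x i ≤ adaptiveCrit α lam g x (rejections α lam g x))).card

/-- The false discovery proportion `V_m / R_m`, with `0 / 0 = 0`. -/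
def FDP (α lam : ℝ) (g : (Set.Ici lam → ℝ) → ℝ) (I₀ : Finset (Fin m)) (x : Fin m → ℝ) : ℝ :=
  (falseRejections α lam g I₀ x : ℝ) / (rejections α lam g x : ℝ)

/-- The vector `x^{(1,lam)}`: the entry at the smallest true null `i` with `x i ≤ lam` is replaced
by `0`; nothing is changed if there is no such `i`. -/
def replaceOne (lam : ℝ) (I₀ : Finset (Fin m)) (x : Fin m → ℝ) : Fin m → ℝ :=
  if h : (I₀.filter (fun i => x i ≤ lam)).Nonempty then
    Function.update x ((I₀.filter (fun i => x i ≤ lam)).min' h) 0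
  else x

/-- `R_m^{(1,lam)}`, the number of rejections of the adaptive test applied to `x^{(1,lam)}`. -/
def rejectionsOne (α lam : ℝ) (g : (Set.Ici lam → ℝ) → ℝ) (I₀ : Finset (Fin m))
    (x : Fin m → ℝ) : ℕ :=
  rejections α lam g (replaceOne lam I₀ x)

/-- `X_m → 0` in `P_m`-probability; the probability space may vary with `m`. -/
def TendstoZeroInProb {Ω : ℕ → Type*} [∀ m, MeasurableSpace (Ω m)] (P : ∀ m, Measure (Ω m))
    (X : ∀ m, Ω m → ℝ) : Prop :=
  ∀ ε : ℝ, 0 < ε → Tendsto (fun m => P m {ω | ε ≤ |X m ω|}) atTop (𝓝 0)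

/-- `X_m → ∞` in `P_m`-probability. -/
def TendstoInftyInProb {Ω : ℕ → Type*} [∀ m, MeasurableSpace (Ω m)] (P : ∀ m, Measure (Ω m))
    (X : ∀ m, Ω m → ℝ) : Prop :=
  ∀ C : ℝ, Tendsto (fun m => P m {ω | X m ω ≤ C}) atTop (𝓝 0)

end

end MultipleTesting

/-! Write `V(lam)` for the number of true nulls with p-value at most `lam` (`nullCnt`). The
estimator sees the empirical distribution function only on `[lam, ∞)`, so moving a p-value inside
`[0, lam]` leaves the critical values unchanged. By (A2) the cap `lam` never matters, and the
threshold is `T = α R / m̂₀`, linear in `R`. If a true null `i` is resampled uniformly on `[0,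
lam]`, it is rejected exactly when it lies below the threshold obtained by putting it to `0`, and
then `R` equals its value for that modified vector. Averaging `1{p_i ≤ T} / R` therefore gives
exactly `rate = α / (lam m̂₀)`: the factor `R` in `T` cancels.

Summed over the true nulls, `FDP` has conditional mean `condFDP = V(lam) · rate`, when the positions
of the true null p-values inside `[0, lam]` are averaged out. The same computation for pairs, where
two factors `1/R` are cancelled by two averages, gives `E (FDP - condFDP)² = E [condFDP /
R^{(1,lam)}] - E [V(lam) rate²]`. Only the diagonal keeps a factor `1/R`, and exchangeability lets
the entry put to `0` be the first true null below `lam`. Together with orthogonality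
(`integral_FDP_mul`, `integral_FDP_sub_condFDP_sq`, `integral_FDP_sub_const_sq`) this decomposes the
variance of `FDP`.

Asymptotically `E [V(lam) rate²]` vanishes, because `V(lam) / m → lam κ₀` while `condFDP ≤ 1`. So
(a) holds iff `condFDP` concentrates and `E [condFDP / R^{(1,lam)}] → 0`. Since `condFDP · (m̂₀ / m)
= (α / lam) · V(lam) / m` is asymptotically constant, `condFDP` concentrates iff `m̂₀ / m` does
(`TendstoZeroInProb.of_mul_eq`). By (A3) `condFDP` stays away from `0` with high probability, so the
other condition says `R^{(1,lam)} → ∞` (`tendsto_integral_condFDP_div_iff`). -/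

namespace MultipleTesting

noncomputable section

variable {m : ℕ}

/-! ### Combinatorics of the adaptive step-up test -/

/-- The number of entries of `x` that are at most `t`. -/
def cnt (x : Fin m → ℝ) (t : ℝ) : ℕ := (Finset.univ.filter (fun i => x i ≤ t)).card

lemma cnt_mono (x : Fin m → ℝ) {s t : ℝ} (h : s ≤ t) : cnt x s ≤ cnt x t :=
  Finset.card_le_card (Finset.monotone_filter_right _ fun _ _ hi => le_trans hi h)

lemma cnt_le (x : Fin m → ℝ) (t : ℝ) : cnt x t ≤ m := by
  simpa [cnt] using Finset.card_filter_le (Finset.univ : Finset (Fin m)) (fun i => x i ≤ t)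

/-- Removes sorting from the argument: the step-up rule becomes a condition on the counting function
alone. -/
lemma orderStat_le_iff (x : Fin m → ℝ) {k : ℕ} (h1 : 1 ≤ k) (h2 : k ≤ m) (c : ℝ) :
    orderStat x k ≤ c ↔ k ≤ cnt x c := by
  have hk : 1 ≤ k ∧ k ≤ m := ⟨h1, h2⟩
  have key := Tuple.lt_card_le_iff_apply_le_of_monotone (f := x ∘ Tuple.sort x) (a := c)
    (j := (⟨k - 1, by omega⟩ : Fin m)) (Tuple.monotone_sort x)
  have hc : (Finset.univ.filter fun i => x (Tuple.sort x i) ≤ c).card = cnt x c := by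
    rw [cnt, ← Fintype.card_subtype, ← Fintype.card_subtype]
    exact Fintype.card_congr ((Tuple.sort x).subtypeEquiv fun i => by simp)
  rw [orderStat, dif_pos hk]
  simp only [Function.comp_apply, hc] at key
  rw [← key]
  omega

/-- Vectors of nonnegative entries at which the estimator is positive and dominates the number of
entries below `lam`. -/
structure Admissible (α lam : ℝ) (g : (Set.Ici lam → ℝ) → ℝ) (x : Fin m → ℝ) : Prop where
  nonneg : ∀ i, 0 ≤ x i
  pos : 0 < g (ecdfTail lam x)
  cnt_mul_le : (cnt x lam : ℝ) * α ≤ lam * g (ecdfTail lam x)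

section

variable {α lam : ℝ} {g : (Set.Ici lam → ℝ) → ℝ} {x : Fin m → ℝ}

/-- The rejection threshold of the adaptive test. -/
def threshold (α lam : ℝ) (g : (Set.Ici lam → ℝ) → ℝ) (x : Fin m → ℝ) : ℝ :=
  adaptiveCrit α lam g x (rejections α lam g x)

lemma threshold_le (α lam : ℝ) (g : (Set.Ici lam → ℝ) → ℝ) (x : Fin m → ℝ) :
    threshold α lam g x ≤ lam := min_le_right _ _

lemma Admissible.adaptiveCrit_mono (h : Admissible α lam g x) (hα : 0 < α) {i j : ℕ}
    (hij : i ≤ j) : adaptiveCrit α lam g x i ≤ adaptiveCrit α lam g x j := by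
  have := h.pos
  unfold adaptiveCrit critValue
  gcongr

lemma le_rejections_of_le_cnt {k : ℕ} (hk : k ≤ m)
    (hc : k ≤ cnt x (adaptiveCrit α lam g x k)) : k ≤ rejections α lam g x := by
  rcases Nat.eq_zero_or_pos k with rfl | h1
  · exact Nat.zero_le _
  · exact Nat.le_findGreatest hk ((orderStat_le_iff x h1 hk _).2 hc)

lemma rejections_le_cnt (α lam : ℝ) (g : (Set.Ici lam → ℝ) → ℝ) (x : Fin m → ℝ) :
    rejections α lam g x ≤ cnt x (threshold α lam g x) := by
  rcases Nat.eq_zero_or_pos (rejections α lam g x) with h0 | h1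
  · rw [h0]; exact Nat.zero_le _
  · rw [← orderStat_le_iff x h1 (Nat.findGreatest_le _)]
    exact Nat.findGreatest_of_ne_zero (m := rejections α lam g x) rfl h1.ne'

lemma rejections_le_cnt_lam (α lam : ℝ) (g : (Set.Ici lam → ℝ) → ℝ) (x : Fin m → ℝ) :
    rejections α lam g x ≤ cnt x lam :=
  (rejections_le_cnt α lam g x).trans (cnt_mono x (threshold_le α lam g x))

/-- If `n` entries lie below the threshold, then `n` is at least the number of rejections, so the
`n`-th critical value is at least the threshold and `n` itself satisfies the step-up condition;
maximality gives equality. This is what makes `FDP` at most `1`. -/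
lemma Admissible.cnt_threshold (h : Admissible α lam g x) (hα : 0 < α) :
    cnt x (threshold α lam g x) = rejections α lam g x := by
  refine le_antisymm ?_ (rejections_le_cnt α lam g x)
  refine le_rejections_of_le_cnt (cnt_le _ _) (cnt_mono x ?_)
  exact h.adaptiveCrit_mono hα (rejections_le_cnt α lam g x)

/-- The domination `cnt_mul_le` makes the cap `lam` inactive, since the number of rejections is at
most the number of entries below `lam`. Linearity in that number is what makes all later averages
exact. -/
lemma Admissible.threshold_eq (h : Admissible α lam g x) (hα : 0 < α) :
    threshold α lam g x = rejections α lam g x / g (ecdfTail lam x) * α := by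
  refine min_eq_left ?_
  have h1 : (rejections α lam g x : ℝ) ≤ cnt x lam := by
    exact_mod_cast rejections_le_cnt_lam α lam g x
  have h2 := h.cnt_mul_le
  have h3 := h.pos
  rw [div_mul_eq_mul_div, div_le_iff₀ h3]
  nlinarith

/-- An entry at most `lam` is counted at every `t ≥ lam`, wherever below `lam` it sits. Hence
estimator and critical values do not react to such moves. -/
lemma ecdfTail_update {i : Fin m} {u : ℝ} (hi : x i ≤ lam) (hu : u ≤ lam) :
    ecdfTail lam (Function.update x i u) = ecdfTail lam x := by
  funext t
  have ht : lam ≤ (t : ℝ) := t.2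
  simp only [ecdfTail, ecdf]
  congr 3
  ext j
  by_cases hj : j = i
  · subst hj; simp [hi.trans ht, hu.trans ht]
  · simp [Function.update_of_ne hj]

lemma cnt_update {i : Fin m} {u t : ℝ} (hi : x i ≤ t) (hu : u ≤ t) :
    cnt (Function.update x i u) t = cnt x t := by
  unfold cnt
  congr 1
  ext j
  by_cases hj : j = i
  · subst hj; simp [hi, hu]
  · simp [Function.update_of_ne hj]

lemma cnt_le_cnt_update {i : Fin m} {u : ℝ} (hu : u ≤ x i) (t : ℝ) :
    cnt x t ≤ cnt (Function.update x i u) t := by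
  refine Finset.card_le_card (Finset.monotone_filter_right _ fun j _ hjt => ?_)
  by_cases hj : j = i
  · subst hj; simpa using hu.trans hjt
  · simpa [Function.update_of_ne hj] using hjt

lemma Admissible.update (h : Admissible α lam g x) {i : Fin m} {u : ℝ} (hi : x i ≤ lam)
    (hu0 : 0 ≤ u) (hu : u ≤ lam) : Admissible α lam g (Function.update x i u) where
  nonneg j := by
    by_cases hj : j = i
    · subst hj; simpa using hu0
    · simpa [Function.update_of_ne hj] using h.nonneg j
  pos := by rw [ecdfTail_update hi hu]; exact h.pos
  cnt_mul_le := by rw [ecdfTail_update hi hu, cnt_update hi hu]; exact h.cnt_mul_le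

lemma adaptiveCrit_update {i : Fin m} {u : ℝ} (hi : x i ≤ lam) (hu : u ≤ lam) :
    adaptiveCrit α lam g (Function.update x i u) = adaptiveCrit α lam g x := by
  unfold adaptiveCrit; rw [ecdfTail_update hi hu]

lemma Admissible.rejections_le_update (h : Admissible α lam g x) (hlam : 0 ≤ lam)
    {i : Fin m} (hi : x i ≤ lam) :
    rejections α lam g x ≤ rejections α lam g (Function.update x i 0) := by
  refine le_rejections_of_le_cnt (Nat.findGreatest_le _) ?_
  rw [adaptiveCrit_update hi hlam]
  exact (rejections_le_cnt α lam g x).trans (cnt_le_cnt_update (h.nonneg i) _)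

lemma threshold_update_of_rejections_eq {i : Fin m} {u : ℝ}
    (hi : x i ≤ lam) (hu : u ≤ lam)
    (h : rejections α lam g (Function.update x i u) = rejections α lam g x) :
    threshold α lam g (Function.update x i u) = threshold α lam g x := by
  unfold threshold
  rw [h, adaptiveCrit_update hi hu]

/-- If the entry `i` is at most the threshold that results from replacing it by `0`, then the
replacement does not change the number of rejections. -/
lemma Admissible.rejections_update_eq (h : Admissible α lam g x) (hlam : 0 ≤ lam)
    {i : Fin m} (hi : x i ≤ threshold α lam g (Function.update x i 0)) :
    rejections α lam g (Function.update x i 0) = rejections α lam g x := by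
  have hil : x i ≤ lam := hi.trans (threshold_le _ _ _ _)
  refine le_antisymm ?_ (h.rejections_le_update hlam hil)
  refine le_rejections_of_le_cnt (Nat.findGreatest_le _) ?_
  rw [← adaptiveCrit_update (α := α) (g := g) hil hlam]
  -- At the threshold of the modified vector both `x i` and `0` are counted, so its number of
  -- rejections also passes the step-up condition for `x`.
  exact (rejections_le_cnt α lam g _).trans (cnt_update hi ((h.nonneg i).trans hi)).le

/-- The right-hand threshold does not depend on `x i`, which allows `x i` to be integrated out. One
direction is monotonicity of the threshold, the other is `rejections_update_eq`. -/
lemma Admissible.le_threshold_iff (h : Admissible α lam g x) (hα : 0 < α) (hlam : 0 ≤ lam)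
    {i : Fin m} (hi : x i ≤ lam) :
    x i ≤ threshold α lam g x ↔ x i ≤ threshold α lam g (Function.update x i 0) := by
  constructor
  · intro hx
    refine hx.trans ?_
    unfold threshold
    rw [adaptiveCrit_update hi hlam]
    exact h.adaptiveCrit_mono hα (h.rejections_le_update hlam hi)
  · intro hx
    rwa [threshold_update_of_rejections_eq hi hlam
      (h.rejections_update_eq hlam hx)] at hx

/-- A zero entry lies below the first critical value. This keeps the denominators in the averaged
formulas nonzero. -/
lemma Admissible.one_le_rejections_update (h : Admissible α lam g x) (hα : 0 < α)
    (hlam : 0 ≤ lam) {i : Fin m} (hi : x i ≤ lam) :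
    1 ≤ rejections α lam g (Function.update x i 0) := by
  have h' := h.update (u := 0) hi le_rfl hlam
  have hm : 1 ≤ m := by have := i.2; omega
  refine le_rejections_of_le_cnt hm ?_
  refine Finset.card_pos.2 ⟨i, ?_⟩
  have := h'.pos
  simp only [Finset.mem_filter, Finset.mem_univ, true_and, Function.update_self]
  unfold adaptiveCrit critValue
  refine le_min (by positivity) hlam

lemma Admissible.threshold_nonneg (h : Admissible α lam g x) (hα : 0 < α) (hlam : 0 ≤ lam) :
    0 ≤ threshold α lam g x := by
  have := h.pos
  unfold threshold adaptiveCrit critValue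
  exact le_min (by positivity) hlam

lemma cnt_comp_perm (σ : Equiv.Perm (Fin m)) (x : Fin m → ℝ) (t : ℝ) :
    cnt (x ∘ σ) t = cnt x t := by
  unfold cnt
  rw [← Fintype.card_subtype, ← Fintype.card_subtype]
  exact Fintype.card_congr (σ.subtypeEquiv fun i => by simp)

lemma ecdfTail_comp_perm (σ : Equiv.Perm (Fin m)) (lam : ℝ) (x : Fin m → ℝ) :
    ecdfTail lam (x ∘ σ) = ecdfTail lam x := by
  funext t
  have := cnt_comp_perm σ x t
  unfold cnt at this
  simp only [ecdfTail, ecdf, this]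

/-- The test depends only on the multiset of entries; this is the source of the exchangeability
argument. -/
lemma rejections_comp_perm (σ : Equiv.Perm (Fin m)) (α lam : ℝ) (g : (Set.Ici lam → ℝ) → ℝ)
    (x : Fin m → ℝ) : rejections α lam g (x ∘ σ) = rejections α lam g x := by
  have key : orderStat (x ∘ σ) = orderStat x := by
    funext k
    by_cases hk : 1 ≤ k ∧ k ≤ m
    · refine eq_of_forall_ge_iff fun c => ?_
      rw [orderStat_le_iff _ hk.1 hk.2, orderStat_le_iff _ hk.1 hk.2, cnt_comp_perm]
    · simp only [orderStat, dif_neg hk]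
  unfold rejections stepUpRejections adaptiveCrit
  rw [key, ecdfTail_comp_perm]

lemma FDP_eq_sum (α lam : ℝ) (g : (Set.Ici lam → ℝ) → ℝ) (I₀ : Finset (Fin m)) (x : Fin m → ℝ) :
    FDP α lam g I₀ x = ∑ i ∈ I₀,
      (if x i ≤ threshold α lam g x then (1 : ℝ) else 0) / rejections α lam g x := by
  rw [← Finset.sum_div, FDP, falseRejections, Finset.card_filter]
  push_cast
  rfl

/-! ### Measurability -/

lemma measurable_cnt {c : (Fin m → ℝ) → ℝ} (hc : Measurable c) :
    Measurable fun x : Fin m → ℝ => cnt x (c x) := by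
  unfold cnt
  simp_rw [Finset.card_filter]
  refine Finset.measurable_sum _ fun i _ => ?_
  exact Measurable.ite (measurableSet_le (measurable_pi_apply i) hc) measurable_const
    measurable_const

lemma measurable_ecdfTail (lam : ℝ) :
    Measurable (ecdfTail lam : (Fin m → ℝ) → Set.Ici lam → ℝ) := by
  refine measurable_pi_lambda _ fun t => ?_
  have := (measurable_cnt (m := m) (measurable_const (a := (t : ℝ))))
  have hc : Measurable fun x : Fin m → ℝ => ((cnt x t : ℕ) : ℝ) := measurable_from_top.comp this
  exact hc.div_const _

lemma measurable_adaptiveCrit (hg : Measurable g) (k : ℕ) :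
    Measurable fun x : Fin m → ℝ => adaptiveCrit α lam g x k := by
  have h := hg.comp (measurable_ecdfTail (m := m) lam)
  unfold adaptiveCrit critValue
  exact ((h.const_div _).mul_const _).min measurable_const

lemma measurable_rejections (hg : Measurable g) :
    Measurable fun x : Fin m → ℝ => rejections α lam g x := by
  refine measurable_findGreatest fun k hk => ?_
  rcases Nat.eq_zero_or_pos k with rfl | h1
  · simp only [orderStat]
    exact measurableSet_le measurable_const (measurable_adaptiveCrit hg 0)
  · simp_rw [orderStat_le_iff _ h1 hk]
    exact measurableSet_le measurable_const (measurable_cnt (measurable_adaptiveCrit hg k))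

lemma measurable_rejections_real (hg : Measurable g) :
    Measurable fun x : Fin m → ℝ => (rejections α lam g x : ℝ) :=
  measurable_from_top.comp (measurable_rejections hg)

lemma measurable_threshold (hg : Measurable g) :
    Measurable fun x : Fin m → ℝ => threshold α lam g x := by
  have h := hg.comp (measurable_ecdfTail (m := m) lam)
  unfold threshold adaptiveCrit critValue
  exact (((measurable_rejections_real hg).div h).mul_const _).min measurable_const

end

/-! ### Resampling a single true null -/

/-- If `(A, B)` is independent of `C` and `A` is independent of `B`, then `A` is independent of
`(B, C)`. -/
lemma indepFun_prodMk_of_indepFun {Ω β γ δ : Type*} [MeasurableSpace Ω] [MeasurableSpace β]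
    [MeasurableSpace γ] [MeasurableSpace δ] {P : Measure Ω} [IsProbabilityMeasure P]
    {A : Ω → β} {B : Ω → γ} {C : Ω → δ} (hA : Measurable A) (hB : Measurable B)
    (hC : Measurable C) (hAB : IndepFun A B P) (hABC : IndepFun (fun ω => (A ω, B ω)) C P) :
    IndepFun A (fun ω => (B ω, C ω)) P := by
  have := Measure.isProbabilityMeasure_map (μ := P) hA.aemeasurable
  have := Measure.isProbabilityMeasure_map (μ := P) hB.aemeasurable
  have := Measure.isProbabilityMeasure_map (μ := P) hC.aemeasurable
  have hBC : IndepFun B C P := hABC.comp measurable_snd measurable_id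
  rw [indepFun_iff_map_prod_eq_prod_map_map (by fun_prop) (by fun_prop)] at hAB hABC hBC ⊢
  -- Both laws are the triple product of the marginals, up to reassociation.
  rw [hBC, ← Measure.prodAssoc_prod, ← hAB, ← hABC,
    Measure.map_map (by fun_prop) (by fun_prop)]
  rfl

variable {Ω : Type*} [MeasurableSpace Ω] {P : Measure Ω}
  {I₀ : Finset (Fin m)} {p : Fin m → Ω → ℝ}

lemma BasicIndependence.measurable_vec (h : BasicIndependence P I₀ p) :
    Measurable fun ω i => p i ω := measurable_pi_lambda _ h.measurable

variable [IsProbabilityMeasure P]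

/-- The distribution function is prescribed on `[0, 1]` only; elsewhere it is fixed because the
p-values lie in `[0, 1]`. -/
lemma BasicIndependence.map_eq (h : BasicIndependence P I₀ p) {i : Fin m} (hi : i ∈ I₀) :
    P.map (p i) = volume.restrict (Set.Icc 0 1) := by
  have := Measure.isProbabilityMeasure_map (μ := P) (h.measurable i).aemeasurable
  refine Measure.ext_of_Iic _ _ fun x => ?_
  rw [Measure.map_apply (h.measurable i) measurableSet_Iic,
    Measure.restrict_apply measurableSet_Iic]
  have hp := h.mem_Icc i
  rcases lt_or_ge x 0 with hx | hx
  · have h1 : p i ⁻¹' Set.Iic x = ∅ := by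
      ext ω; simp; linarith [(hp ω).1]
    have h2 : Set.Iic x ∩ Set.Icc (0 : ℝ) 1 = ∅ := by
      ext y; simp; intros; linarith
    simp [h1, h2]
  rcases le_or_gt x 1 with hx1 | hx1
  · have h2 : Set.Iic x ∩ Set.Icc (0 : ℝ) 1 = Set.Icc 0 x := by
      ext y; simp; constructor
      · rintro ⟨a, b, c⟩; exact ⟨b, a⟩
      · rintro ⟨a, b⟩; exact ⟨b, a, b.trans hx1⟩
    rw [h2, Real.volume_Icc, sub_zero, ← h.uniform_null i hi x ⟨hx, hx1⟩]
    rfl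
  · have h1 : p i ⁻¹' Set.Iic x = Set.univ := by
      ext ω; simp; linarith [(hp ω).2]
    have h2 : Set.Iic x ∩ Set.Icc (0 : ℝ) 1 = Set.Icc 0 1 := by
      ext y; simp; intros; linarith
    simp [h1, h2]

/-- Putting coordinate `i` to `0` encodes the vector of all other coordinates without changing its
type. It is a measurable function `ψ` of the other true nulls and the false nulls, which are jointly
independent of `p i`. -/
lemma BasicIndependence.indepFun_update (h : BasicIndependence P I₀ p) {i : Fin m} (hi : i ∈ I₀) :
    IndepFun (p i) (fun ω => Function.update (fun j => p j ω) i 0) P := by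
  classical
  have hm := h.measurable
  set i' : {j // j ∈ I₀} := ⟨i, hi⟩
  set T : Finset {j // j ∈ I₀} := Finset.univ.erase i'
  have hAB : IndepFun (p i) (fun ω (j : T) => p j ω) P := by
    have := h.indep_null.indepFun_finset {i'} T (by simp [T]) (fun j => hm j)
    refine this.comp (φ := fun z : ({i'} : Finset {j // j ∈ I₀}) → ℝ => z ⟨i', by simp⟩) (ψ := id)
      ?_ measurable_id
    exact measurable_pi_apply _
  have hABC : IndepFun (fun ω => (p i ω, fun (j : T) => p j ω))
      (fun ω (j : {j // j ∉ I₀}) => p j ω) P := by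
    refine h.indep_null_alt.comp (φ := fun z : {j // j ∈ I₀} → ℝ => (z i', fun j : T => z j))
      (ψ := id) ?_ measurable_id
    exact (measurable_pi_apply _).prodMk (measurable_pi_lambda _ fun j => measurable_pi_apply _)
  have hB : Measurable fun ω (j : T) => p j ω := measurable_pi_lambda _ fun j => hm j
  have hC : Measurable fun ω (j : {j // j ∉ I₀}) => p j ω := measurable_pi_lambda _ fun j => hm j
  have key := indepFun_prodMk_of_indepFun (hm i) hB hC hAB hABC
  let ψ : (T → ℝ) × ({j // j ∉ I₀} → ℝ) → Fin m → ℝ := fun z j =>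
    if hj : j ∈ I₀ then if hji : j = i then 0 else z.1 ⟨⟨j, hj⟩, by simp [T, i', hji]⟩
    else z.2 ⟨j, hj⟩
  have hψ : Measurable ψ := by
    refine measurable_pi_lambda _ fun j => ?_
    by_cases hj : j ∈ I₀
    · by_cases hji : j = i
      · simp only [ψ, dif_pos hj, dif_pos hji]; exact measurable_const
      · simp only [ψ, dif_pos hj, dif_neg hji]; exact (measurable_pi_apply _).comp measurable_fst
    · simp only [ψ, dif_neg hj]; exact (measurable_pi_apply _).comp measurable_snd
  have hcomp := key.comp measurable_id hψ
  rw [Function.id_comp] at hcomp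
  convert hcomp using 1
  funext ω j
  by_cases hj : j ∈ I₀
  · by_cases hji : j = i
    · subst hji; simp [ψ, hj]
    · simp [ψ, hj, hji]
  · have hji : j ≠ i := fun e => hj (e ▸ hi)
    simp [ψ, hj, hji]

/-- Given that a true null `p i` is at most `lam`, it may be resampled uniformly on `[0, lam]`. -/
lemma BasicIndependence.integral_resample (h : BasicIndependence P I₀ p) {i : Fin m} (hi : i ∈ I₀)
    {lam : ℝ} (hlam0 : 0 < lam) (hlam1 : lam < 1) {f : (Fin m → ℝ) → ℝ} (hf : Measurable f)
    (hint : Integrable (fun ω => (if p i ω ≤ lam then (1 : ℝ) else 0) * f (fun j => p j ω)) P) :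
    ∫ ω, (if p i ω ≤ lam then (1 : ℝ) else 0) * f (fun j => p j ω) ∂P =
      lam⁻¹ * ∫ ω, (if p i ω ≤ lam then (1 : ℝ) else 0) *
        (∫ u in Set.Icc 0 lam, f (Function.update (fun j => p j ω) i u)) ∂P := by
  have hmi := h.measurable i
  have hmY : Measurable fun ω => Function.update (fun j => p j ω) i 0 :=
    measurable_update_left.comp h.measurable_vec
  have hlaw := (indepFun_iff_map_prod_eq_prod_map_map hmi.aemeasurable hmY.aemeasurable).1
    (h.indepFun_update hi)
  rw [h.map_eq hi] at hlaw
  set ν := P.map fun ω => Function.update (fun j => p j ω) i 0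
  have : IsProbabilityMeasure ν := Measure.isProbabilityMeasure_map hmY.aemeasurable
  have hind : Measurable fun u : ℝ => if u ≤ lam then (1 : ℝ) else 0 :=
    Measurable.ite measurableSet_Iic measurable_const measurable_const
  have hupd : Measurable fun z : ℝ × (Fin m → ℝ) => Function.update z.2 i z.1 := by
    refine measurable_pi_lambda _ fun j => ?_
    by_cases hj : j = i
    · subst hj; simpa using measurable_fst
    · simp only [Function.update_of_ne hj]; exact (measurable_pi_apply j).comp measurable_snd
  -- The integrand as a function of `p i` and the rest; slot `i` of the rest is overwritten, so its
  -- value `0` is harmless.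
  set G : ℝ × (Fin m → ℝ) → ℝ := fun z =>
    (if z.1 ≤ lam then (1 : ℝ) else 0) * f (Function.update z.2 i z.1) with hG
  have hGm : Measurable G := (hind.comp measurable_fst).mul (hf.comp hupd)
  set H : (Fin m → ℝ) → ℝ := fun y => ∫ u in Set.Icc 0 lam, f (Function.update y i u) with hH
  have hGp : ∀ ω, (if p i ω ≤ lam then (1 : ℝ) else 0) * f (fun j => p j ω)
      = G (p i ω, Function.update (fun j => p j ω) i 0) := by
    intro ω
    simp only [hG, Function.update_idem]
    congr 2
    exact (Function.update_eq_self i (fun j => p j ω)).symm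
  have hHp : ∀ ω, H (fun j => p j ω) = H (Function.update (fun j => p j ω) i 0) := by
    intro ω; simp only [hH, Function.update_idem]
  have hinner : ∀ y, ∫ u in Set.Icc 0 1, G (u, y) = H y := by
    intro y
    simp only [hG, hH]
    rw [← integral_indicator measurableSet_Icc, ← integral_indicator measurableSet_Icc]
    congr 1
    funext u
    simp only [Set.indicator, Set.mem_Icc]
    split_ifs <;> (simp_all; try linarith)
  have hHm : AEStronglyMeasurable H ν := by
    have := hGm.stronglyMeasurable.integral_prod_left' (μ := volume.restrict (Set.Icc (0 : ℝ) 1))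
    simp only [hinner] at this
    exact this.aestronglyMeasurable
  -- The inner average `H` ignores coordinate `i`, so the indicator kept on the right-hand side
  -- factors out with probability `lam` and cancels `lam⁻¹`.
  have hlam : ∫ u in Set.Icc (0 : ℝ) 1, (if u ≤ lam then (1 : ℝ) else 0) = lam := by
    rw [← integral_indicator measurableSet_Icc]
    have : (Set.Icc (0 : ℝ) 1).indicator (fun u => if u ≤ lam then (1 : ℝ) else 0) =
        (Set.Icc 0 lam).indicator fun _ => 1 := by
      funext u
      simp only [Set.indicator, Set.mem_Icc]
      split_ifs <;> (simp_all; try linarith)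
    rw [this, integral_indicator measurableSet_Icc]
    simp [hlam0.le]
  simp only [hGp] at hint ⊢
  have hpair : Measurable fun ω => (p i ω, Function.update (fun j => p j ω) i 0) := hmi.prodMk hmY
  have hintG : Integrable G ((volume.restrict (Set.Icc (0 : ℝ) 1)).prod ν) := by
    rw [← hlaw, integrable_map_measure hGm.aestronglyMeasurable hpair.aemeasurable]
    exact hint
  rw [← integral_map (φ := fun ω => (p i ω, Function.update (fun j => p j ω) i 0))
    hpair.aemeasurable (f := G) hGm.aestronglyMeasurable, hlaw, integral_prod_symm _ hintG]
  simp only [hinner]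
  change _ = lam⁻¹ * ∫ ω, (if p i ω ≤ lam then (1 : ℝ) else 0) * H (fun j => p j ω) ∂P
  simp only [hHp]
  have hprod : AEStronglyMeasurable
      (fun z : ℝ × (Fin m → ℝ) => (if z.1 ≤ lam then (1 : ℝ) else 0) * H z.2)
      ((volume.restrict (Set.Icc (0 : ℝ) 1)).prod ν) :=
    ((hind.comp measurable_fst).aestronglyMeasurable).mul hHm.comp_snd
  rw [← integral_map (φ := fun ω => (p i ω, Function.update (fun j => p j ω) i 0))
    hpair.aemeasurable
    (f := fun z : ℝ × (Fin m → ℝ) => (if z.1 ≤ lam then (1 : ℝ) else 0) * H z.2)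
    (by rw [hlaw]; exact hprod), hlaw,
    integral_prod_mul (fun u : ℝ => if u ≤ lam then (1 : ℝ) else 0) H, hlam,
    inv_mul_cancel_left₀ (ne_of_gt hlam0)]

/-- Functions with the same average over `[0, lam]` in the coordinate of a true null `i` have the
same expectation on `{p i ≤ lam}`. -/
lemma BasicIndependence.integral_congr_of_average (h : BasicIndependence P I₀ p) {i : Fin m}
    (hi : i ∈ I₀) {lam : ℝ} (hlam0 : 0 < lam) (hlam1 : lam < 1) {f f' : (Fin m → ℝ) → ℝ}
    (hf : Measurable f) (hf' : Measurable f')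
    (hint : Integrable (fun ω => (if p i ω ≤ lam then (1 : ℝ) else 0) * f (fun j => p j ω)) P)
    (hint' : Integrable (fun ω => (if p i ω ≤ lam then (1 : ℝ) else 0) * f' (fun j => p j ω)) P)
    (hff' : ∀ ω, p i ω ≤ lam → ∫ u in Set.Icc 0 lam, f (Function.update (fun j => p j ω) i u) =
      ∫ u in Set.Icc 0 lam, f' (Function.update (fun j => p j ω) i u)) :
    ∫ ω, (if p i ω ≤ lam then (1 : ℝ) else 0) * f (fun j => p j ω) ∂P =
      ∫ ω, (if p i ω ≤ lam then (1 : ℝ) else 0) * f' (fun j => p j ω) ∂P := by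
  rw [h.integral_resample hi hlam0 hlam1 hf hint, h.integral_resample hi hlam0 hlam1 hf' hint']
  congr 2
  funext ω
  split_ifs with hω
  · rw [hff' ω hω]
  · simp

/-! ### Second moments of the false discovery proportion -/

/-- The indicator of `u ≤ t`. -/
abbrev indLE (t u : ℝ) : ℝ := if u ≤ t then 1 else 0

lemma indLE_nonneg (t u : ℝ) : 0 ≤ indLE t u := by unfold indLE; split_ifs <;> norm_num

lemma indLE_le_one (t u : ℝ) : indLE t u ≤ 1 := by unfold indLE; split_ifs <;> norm_num

lemma inv_natCast_le_one (n : ℕ) : ((n : ℝ))⁻¹ ≤ 1 := by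
  rcases Nat.eq_zero_or_pos n with rfl | h
  · simp
  · exact inv_le_one_of_one_le₀ (by exact_mod_cast h)

lemma measurable_indLE {β : Type*} [MeasurableSpace β] {t u : β → ℝ} (ht : Measurable t)
    (hu : Measurable u) : Measurable fun x => indLE (t x) (u x) :=
  Measurable.ite (measurableSet_le hu ht) measurable_const measurable_const

/-- The conditional rejection probability of a true null divided by the number of rejections. -/
def rate (α lam : ℝ) (g : (Set.Ici lam → ℝ) → ℝ) (x : Fin m → ℝ) : ℝ :=
  α / (lam * g (ecdfTail lam x))

/-- The number of true nulls with entry at most `lam`. -/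
def nullCnt (lam : ℝ) (I₀ : Finset (Fin m)) (x : Fin m → ℝ) : ℝ := ∑ i ∈ I₀, indLE lam (x i)

/-- The conditional expectation of the false discovery proportion given the entries above `lam`. -/
def condFDP (α lam : ℝ) (g : (Set.Ici lam → ℝ) → ℝ) (I₀ : Finset (Fin m)) (x : Fin m → ℝ) : ℝ :=
  nullCnt lam I₀ x * rate α lam g x

/-- The indicator of `k` being the smallest true null with entry at most `lam`. -/
def firstInd (lam : ℝ) (I₀ : Finset (Fin m)) (k : Fin m) (x : Fin m → ℝ) : ℝ :=
  if x k ≤ lam ∧ ∀ l ∈ I₀, l < k → ¬ x l ≤ lam then 1 else 0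

/-! ### Behaviour of the conditional quantities when one entry moves below `lam` -/

section pointwise

variable {α lam : ℝ} {g : (Set.Ici lam → ℝ) → ℝ} {x : Fin m → ℝ} {I₀ : Finset (Fin m)}

lemma update_le_iff {i j : Fin m} {u : ℝ} (hi : x i ≤ lam) (hu : u ≤ lam) :
    Function.update x i u j ≤ lam ↔ x j ≤ lam := by
  by_cases hj : j = i
  · subst hj; simp [hi, hu]
  · simp [Function.update_of_ne hj]

lemma rate_update {i : Fin m} {u : ℝ} (hi : x i ≤ lam) (hu : u ≤ lam) :
    rate α lam g (Function.update x i u) = rate α lam g x := by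
  unfold rate; rw [ecdfTail_update hi hu]

lemma indLE_update {i j : Fin m} {u : ℝ} (hi : x i ≤ lam) (hu : u ≤ lam) :
    indLE lam (Function.update x i u j) = indLE lam (x j) := by
  unfold indLE; simp only [update_le_iff hi hu]

lemma nullCnt_update {i : Fin m} {u : ℝ} (hi : x i ≤ lam) (hu : u ≤ lam) :
    nullCnt lam I₀ (Function.update x i u) = nullCnt lam I₀ x := by
  unfold nullCnt; simp only [indLE_update hi hu]

lemma condFDP_update {i : Fin m} {u : ℝ} (hi : x i ≤ lam) (hu : u ≤ lam) :
    condFDP α lam g I₀ (Function.update x i u) = condFDP α lam g I₀ x := by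
  unfold condFDP; rw [nullCnt_update hi hu, rate_update hi hu]

lemma firstInd_update {i k : Fin m} {u : ℝ} (hi : x i ≤ lam) (hu : u ≤ lam) :
    firstInd lam I₀ k (Function.update x i u) = firstInd lam I₀ k x := by
  unfold firstInd; simp only [update_le_iff hi hu]

lemma nullCnt_nonneg (lam : ℝ) (I₀ : Finset (Fin m)) (x : Fin m → ℝ) : 0 ≤ nullCnt lam I₀ x :=
  Finset.sum_nonneg fun _ _ => indLE_nonneg _ _

lemma nullCnt_eq_card (lam : ℝ) (I₀ : Finset (Fin m)) (x : Fin m → ℝ) :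
    nullCnt lam I₀ x = ((I₀.filter fun i => x i ≤ lam).card : ℝ) := by
  rw [nullCnt, Finset.card_filter]; push_cast; rfl

lemma nullCnt_le_cnt (lam : ℝ) (I₀ : Finset (Fin m)) (x : Fin m → ℝ) :
    nullCnt lam I₀ x ≤ cnt x lam := by
  rw [nullCnt_eq_card, cnt]
  exact_mod_cast Finset.card_le_card (Finset.filter_subset_filter _ (Finset.subset_univ _))

lemma Admissible.rate_pos (h : Admissible α lam g x) (hα : 0 < α) (hlam : 0 < lam) :
    0 < rate α lam g x := by
  have := h.pos
  unfold rate; positivity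

lemma condFDP_nonneg (h : Admissible α lam g x) (hα : 0 < α) (hlam : 0 < lam) :
    0 ≤ condFDP α lam g I₀ x :=
  mul_nonneg (nullCnt_nonneg _ _ _) (h.rate_pos hα hlam).le

lemma Admissible.cnt_mul_rate_le_one (h : Admissible α lam g x) (hlam : 0 < lam) :
    cnt x lam * rate α lam g x ≤ 1 := by
  have := h.pos
  have h2 := h.cnt_mul_le
  unfold rate
  rw [← mul_div_assoc]
  exact div_le_one_of_le₀ h2 (by positivity)

lemma condFDP_le_one (h : Admissible α lam g x) (hα : 0 < α) (hlam : 0 < lam) :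
    condFDP α lam g I₀ x ≤ 1 :=
  (mul_le_mul_of_nonneg_right (nullCnt_le_cnt lam I₀ x) (h.rate_pos hα hlam).le).trans
    (h.cnt_mul_rate_le_one hlam)

/-- With no entry below `lam` the domination of the count says nothing and the rate may be
arbitrarily large. Bounds on the rate therefore always use an indicator of some `x i ≤ lam`. -/
lemma Admissible.rate_le_one (h : Admissible α lam g x) (hα : 0 < α) (hlam : 0 < lam)
    {i : Fin m} (hi : x i ≤ lam) : rate α lam g x ≤ 1 := by
  have h1 : (1 : ℝ) ≤ cnt x lam := by
    exact_mod_cast Finset.card_pos.2 ⟨i, by simpa using hi⟩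
  have h2 := h.cnt_mul_rate_le_one hlam
  have h3 := h.rate_pos hα hlam
  exact (le_mul_of_one_le_left h3.le h1).trans h2

lemma Admissible.indLE_mul_rate (h : Admissible α lam g x) (hα : 0 < α) (hlam : 0 < lam)
    (i : Fin m) : |indLE lam (x i) * rate α lam g x| ≤ 1 := by
  unfold indLE
  have := h.rate_pos hα hlam
  split_ifs with hi
  · rw [one_mul, abs_of_pos this]; exact h.rate_le_one hα hlam hi
  · simp

/-- Averaging over the coordinate `i` replaces the indicator of its rejection by the threshold. -/
lemma Admissible.integral_rejected (h : Admissible α lam g x) (hα : 0 < α) (hlam : 0 < lam)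
    {i : Fin m} (hi : x i ≤ lam) (Φ : ℝ → ℕ → ℝ) :
    ∫ u in Set.Icc 0 lam, indLE (threshold α lam g (Function.update x i u)) u *
        Φ (threshold α lam g (Function.update x i u)) (rejections α lam g (Function.update x i u)) =
      threshold α lam g (Function.update x i 0) *
        Φ (threshold α lam g (Function.update x i 0))
          (rejections α lam g (Function.update x i 0)) := by
  set T := threshold α lam g (Function.update x i 0) with hT
  have hT0 : 0 ≤ T := (h.update hi le_rfl hlam.le).threshold_nonneg hα hlam.le
  have hTl : T ≤ lam := threshold_le _ _ _ _
  -- For `u ≤ T` threshold and rejections are frozen at their values for `u = 0`; for `u > T` the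
  -- indicator vanishes. So the integrand is constant on `[0, T]` and zero beyond, for any `Φ`.
  have key : ∀ u ∈ Set.Icc 0 lam, indLE (threshold α lam g (Function.update x i u)) u *
        Φ (threshold α lam g (Function.update x i u)) (rejections α lam g (Function.update x i u)) =
      (Set.Icc 0 T).indicator (fun _ => Φ T (rejections α lam g (Function.update x i 0))) u := by
    rintro u ⟨hu0, hu⟩
    have hy := h.update hi hu0 hu
    have hyi : Function.update x i u i = u := by simp
    have hyi' : Function.update x i u i ≤ lam := by simpa using hu
    have hiff := hy.le_threshold_iff hα hlam.le hyi'
    rw [Function.update_idem, hyi, ← hT] at hiff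
    by_cases huT : u ≤ T
    · have hr : rejections α lam g (Function.update x i 0)
          = rejections α lam g (Function.update x i u) := by
        have := hy.rejections_update_eq hlam.le (i := i)
          (by rw [Function.update_idem, hyi]; exact huT)
        rwa [Function.update_idem] at this
      have ht : T = threshold α lam g (Function.update x i u) := by
        have := threshold_update_of_rejections_eq (α := α) (g := g) hyi' hlam.le (u := 0)
          (by rw [Function.update_idem]; exact hr)
        rwa [Function.update_idem] at this
      rw [Set.indicator_of_mem (show u ∈ Set.Icc 0 T from ⟨hu0, huT⟩), ← hr, ← ht, indLE,
        if_pos huT, one_mul]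
    · rw [Set.indicator_of_notMem (fun hh => huT hh.2), indLE, if_neg (fun hh => huT (hiff.1 hh)),
        zero_mul]
  rw [setIntegral_congr_fun measurableSet_Icc key, setIntegral_indicator measurableSet_Icc,
    Set.inter_eq_right.2 (Set.Icc_subset_Icc_right hTl)]
  simp [hT0]

lemma setIntegral_Icc_const (hlam : 0 < lam) (c : ℝ) : ∫ _ in Set.Icc 0 lam, c = lam * c := by
  simp [hlam.le]

/-- The length of the rejection interval contains the factor that cancels one inverse number of
rejections. -/
lemma Admissible.threshold_update_eq (h : Admissible α lam g x) (hα : 0 < α) (hlam : 0 < lam)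
    {i : Fin m} (hi : x i ≤ lam) : threshold α lam g (Function.update x i 0) =
      lam * rate α lam g x * rejections α lam g (Function.update x i 0) := by
  have := h.pos
  rw [(h.update hi le_rfl hlam.le).threshold_eq hα, ecdfTail_update hi hlam.le, rate]
  field_simp

lemma Admissible.rejections_update_ne_zero (h : Admissible α lam g x) (hα : 0 < α)
    (hlam : 0 < lam) {i : Fin m} (hi : x i ≤ lam) :
    (rejections α lam g (Function.update x i 0) : ℝ) ≠ 0 := by
  have := h.one_le_rejections_update hα hlam.le hi
  exact_mod_cast (by omega : rejections α lam g (Function.update x i 0) ≠ 0)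

/-- Exactly one `firstInd` is nonzero. Summing over `k` trades the random index in `replaceOne` for
fixed ones, to which resampling applies. -/
lemma sum_firstInd_mul (hne : (I₀.filter fun i => x i ≤ lam).Nonempty) (c : Fin m → ℝ) :
    ∑ k ∈ I₀, firstInd lam I₀ k x * c k = c ((I₀.filter fun i => x i ≤ lam).min' hne) := by
  set k₀ := (I₀.filter fun i => x i ≤ lam).min' hne with hk₀
  have hmem := Finset.mem_filter.1 (Finset.min'_mem _ hne)
  have hle : ∀ l ∈ I₀, x l ≤ lam → k₀ ≤ l := fun l hl hx =>
    Finset.min'_le _ _ (Finset.mem_filter.2 ⟨hl, hx⟩)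
  rw [Finset.sum_eq_single_of_mem k₀ hmem.1]
  · rw [firstInd, if_pos, one_mul]
    exact ⟨hmem.2, fun l hl hlt hx => absurd (hle l hl hx) (not_le.2 hlt)⟩
  · intro k hk hne'
    rw [firstInd, if_neg, zero_mul]
    rintro ⟨h1, h2⟩
    exact h2 k₀ hmem.1 (lt_of_le_of_ne (hle k hk h1) hne'.symm) hmem.2

lemma sum_firstInd_div_rejections (α lam : ℝ) (g : (Set.Ici lam → ℝ) → ℝ) (I₀ : Finset (Fin m))
    (x : Fin m → ℝ) {i : Fin m} (hi : i ∈ I₀) :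
    indLE lam (x i) * ∑ k ∈ I₀, firstInd lam I₀ k x *
      (rejections α lam g (Function.update x k 0) : ℝ)⁻¹ =
    indLE lam (x i) * (rejectionsOne α lam g I₀ x : ℝ)⁻¹ := by
  unfold indLE
  split_ifs with hx
  · have hne : (I₀.filter fun i => x i ≤ lam).Nonempty := ⟨i, Finset.mem_filter.2 ⟨hi, hx⟩⟩
    rw [sum_firstInd_mul hne, rejectionsOne, replaceOne, dif_pos hne]
  · simp

lemma sum_firstInd {i : Fin m} (hi : i ∈ I₀) :
    indLE lam (x i) * ∑ k ∈ I₀, firstInd lam I₀ k x = indLE lam (x i) := by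
  unfold indLE
  split_ifs with hx
  · have hne : (I₀.filter fun i => x i ≤ lam).Nonempty := ⟨i, Finset.mem_filter.2 ⟨hi, hx⟩⟩
    simpa using sum_firstInd_mul hne (fun _ => 1)
  · simp

lemma condFDP_div_rejectionsOne (α lam : ℝ) (g : (Set.Ici lam → ℝ) → ℝ) (I₀ : Finset (Fin m))
    (x : Fin m → ℝ) :
    condFDP α lam g I₀ x / rejectionsOne α lam g I₀ x = ∑ i ∈ I₀, ∑ k ∈ I₀,
      indLE lam (x i) * (firstInd lam I₀ k x * rate α lam g x *
        (rejections α lam g (Function.update x k 0) : ℝ)⁻¹) := by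
  have : ∀ i ∈ I₀, ∑ k ∈ I₀, indLE lam (x i) * (firstInd lam I₀ k x * rate α lam g x *
        (rejections α lam g (Function.update x k 0) : ℝ)⁻¹)
      = rate α lam g x * (indLE lam (x i) * (rejectionsOne α lam g I₀ x : ℝ)⁻¹) := by
    intro i hi
    rw [← sum_firstInd_div_rejections α lam g I₀ x hi, Finset.mul_sum, Finset.mul_sum]
    exact Finset.sum_congr rfl fun k _ => by ring
  rw [Finset.sum_congr rfl this, ← Finset.mul_sum, ← Finset.sum_mul, condFDP, nullCnt]
  ring

/-- The two vectors differ by the transposition of `i` and `k`. -/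
lemma rejections_update_swap (α lam : ℝ) (g : (Set.Ici lam → ℝ) → ℝ) (x : Fin m → ℝ)
    {i k : Fin m} (hik : i ≠ k) (u v : ℝ) :
    rejections α lam g (Function.update (Function.update x i u) k v) =
      rejections α lam g (Function.update (Function.update x k u) i v) := by
  rw [← rejections_comp_perm (Equiv.swap i k) α lam g (Function.update (Function.update x k u) i v)]
  congr 1
  funext j
  by_cases hji : j = i
  · subst hji; simp [Function.update_of_ne hik, Function.update_of_ne hik.symm]
  by_cases hjk : j = k
  · subst hjk; simp
  simp [Equiv.swap_apply_of_ne_of_ne hji hjk, hji, hjk]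

end pointwise

/-! ### Measurability of the conditional quantities -/

section measurability

variable {α lam : ℝ} {g : (Set.Ici lam → ℝ) → ℝ} {I₀ : Finset (Fin m)}

lemma measurable_rate (hg : Measurable g) : Measurable fun x : Fin m → ℝ => rate α lam g x :=
  ((hg.comp (measurable_ecdfTail lam)).const_mul lam).const_div α

lemma measurable_indLE_apply (lam : ℝ) (i : Fin m) :
    Measurable fun x : Fin m → ℝ => indLE lam (x i) :=
  measurable_indLE measurable_const (measurable_pi_apply i)

lemma measurable_nullCnt : Measurable fun x : Fin m → ℝ => nullCnt lam I₀ x :=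
  Finset.measurable_sum _ fun i _ => measurable_indLE_apply lam i

lemma measurable_condFDP (hg : Measurable g) :
    Measurable fun x : Fin m → ℝ => condFDP α lam g I₀ x :=
  measurable_nullCnt.mul (measurable_rate hg)

lemma measurable_firstInd (k : Fin m) : Measurable fun x : Fin m → ℝ => firstInd lam I₀ k x := by
  have h : ∀ i : Fin m, MeasurableSet {x : Fin m → ℝ | x i ≤ lam} := fun i =>
    measurableSet_le (measurable_pi_apply i) measurable_const
  refine Measurable.ite ?_ measurable_const measurable_const
  have : {x : Fin m → ℝ | x k ≤ lam ∧ ∀ l ∈ I₀, l < k → ¬ x l ≤ lam} =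
      {x | x k ≤ lam} ∩ ⋂ l ∈ I₀, ⋂ _ : l < k, {x | x l ≤ lam}ᶜ := by
    ext x; simp
  rw [this]
  exact (h k).inter (MeasurableSet.iInter fun l => MeasurableSet.iInter fun _ =>
    MeasurableSet.iInter fun _ => (h l).compl)

lemma measurable_indLE_threshold (hg : Measurable g) (i : Fin m) :
    Measurable fun x : Fin m → ℝ => indLE (threshold α lam g x) (x i) :=
  measurable_indLE (measurable_threshold hg) (measurable_pi_apply i)

lemma measurable_update_zero (i : Fin m) :
    Measurable fun x : Fin m → ℝ => Function.update x i 0 := measurable_update_left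

lemma measurable_inv_rejections (hg : Measurable g) :
    Measurable fun x : Fin m → ℝ => (rejections α lam g x : ℝ)⁻¹ :=
  (measurable_rejections_real hg).inv

lemma measurable_FDP (hg : Measurable g) : Measurable fun x : Fin m → ℝ => FDP α lam g I₀ x := by
  simp_rw [FDP_eq_sum]
  exact Finset.measurable_sum _ fun i _ =>
    (measurable_indLE_threshold hg i).div (measurable_rejections_real hg)

end measurability

/-! ### Exact expectations by averaging over one or two true nulls -/

section moments

variable {Ω : Type*} [MeasurableSpace Ω] {P : Measure Ω} [IsProbabilityMeasure P]
  {I₀ : Finset (Fin m)} {p : Fin m → Ω → ℝ} {α lam : ℝ} {g : (Set.Ici lam → ℝ) → ℝ}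

lemma BasicIndependence.integrable_of_bound (h : BasicIndependence P I₀ p) {f : (Fin m → ℝ) → ℝ}
    (hf : Measurable f) {C : ℝ} (hC : ∀ ω, |f (fun j => p j ω)| ≤ C) :
    Integrable (fun ω => f (fun j => p j ω)) P :=
  Integrable.of_bound (hf.comp h.measurable_vec).aestronglyMeasurable C (ae_of_all _ hC)

lemma abs_mul_le_one {a b : ℝ} (ha : |a| ≤ 1) (hb : |b| ≤ 1) : |a * b| ≤ 1 := by
  rw [abs_mul]; exact mul_le_one₀ ha (abs_nonneg _) hb

lemma abs_indLE_le_one (t u : ℝ) : |indLE t u| ≤ 1 := by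
  rw [abs_of_nonneg (indLE_nonneg _ _)]; exact indLE_le_one _ _

lemma abs_inv_natCast_le_one (n : ℕ) : |((n : ℝ))⁻¹| ≤ 1 := by
  rw [abs_of_nonneg (by positivity)]; exact inv_natCast_le_one n

lemma abs_firstInd_le_one (lam : ℝ) (I₀ : Finset (Fin m)) (k : Fin m) (x : Fin m → ℝ) :
    |firstInd lam I₀ k x| ≤ 1 := by
  unfold firstInd; split_ifs <;> simp

/-- Since the threshold is at most `lam`, the factor `indLE lam u` may be inserted freely, as the
resampling lemmas require. -/
lemma indLE_mul_indLE_threshold (α lam : ℝ) (g : (Set.Ici lam → ℝ) → ℝ) (x : Fin m → ℝ) (u : ℝ) :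
    indLE lam u * indLE (threshold α lam g x) u = indLE (threshold α lam g x) u := by
  unfold indLE
  by_cases hu : u ≤ threshold α lam g x
  · simp [hu, hu.trans (threshold_le α lam g x)]
  · simp [hu]

/-- The expectation of a rejection indicator of a true null, weighted by the inverse number of
rejections and a function of the entries above `lam`. -/
lemma BasicIndependence.integral_rejected_mul (h : BasicIndependence P I₀ p) (hα : 0 < α)
    (hlam0 : 0 < lam) (hlam1 : lam < 1) (hg : Measurable g)
    (hadm : ∀ ω, Admissible α lam g fun j => p j ω) {φ : (Fin m → ℝ) → ℝ} (hφ : Measurable φ)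
    (hφb : ∀ ω, |φ fun j => p j ω| ≤ 1) {i : Fin m} (hi : i ∈ I₀)
    (hφi : ∀ x u, x i ≤ lam → u ≤ lam → φ (Function.update x i u) = φ x) :
    ∫ ω, indLE lam (p i ω) * (indLE (threshold α lam g fun j => p j ω) (p i ω) *
        (rejections α lam g fun j => p j ω : ℝ)⁻¹ * φ fun j => p j ω) ∂P =
      ∫ ω, indLE lam (p i ω) * (rate α lam g (fun j => p j ω) * φ fun j => p j ω) ∂P := by
  have hf : Measurable fun x : Fin m → ℝ => indLE (threshold α lam g x) (x i) *
      (rejections α lam g x : ℝ)⁻¹ * φ x :=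
    ((measurable_indLE_threshold hg i).mul (measurable_inv_rejections hg)).mul hφ
  have hf' : Measurable fun x : Fin m → ℝ => rate α lam g x * φ x := (measurable_rate hg).mul hφ
  have hind := measurable_indLE_apply (m := m) lam i
  refine h.integral_congr_of_average hi hlam0 hlam1 hf hf'
    (h.integrable_of_bound (hind.mul hf) (C := 1) fun ω => ?_)
    (h.integrable_of_bound (hind.mul hf') (C := 1) fun ω => ?_) fun ω hω => ?_
  · exact abs_mul_le_one (abs_indLE_le_one _ _) (abs_mul_le_one (abs_mul_le_one
      (abs_indLE_le_one _ _) (abs_inv_natCast_le_one _)) (hφb ω))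
  · simp only [Pi.mul_apply]
    rw [← mul_assoc]
    exact abs_mul_le_one ((hadm ω).indLE_mul_rate hα hlam0 i) (hφb ω)
  · set x : Fin m → ℝ := fun j => p j ω
    have hax : Admissible α lam g x := hadm ω
    have e1 : ∀ u ∈ Set.Icc 0 lam, indLE (threshold α lam g (Function.update x i u))
        (Function.update x i u i) * (rejections α lam g (Function.update x i u) : ℝ)⁻¹ *
          φ (Function.update x i u) =
        indLE (threshold α lam g (Function.update x i u)) u *
          (fun (_ : ℝ) (n : ℕ) => (n : ℝ)⁻¹ * φ x) (threshold α lam g (Function.update x i u))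
            (rejections α lam g (Function.update x i u)) := by
      intro u hu
      simp only [hφi x u hω hu.2, Function.update_self]
      ring
    have e2 : ∀ u ∈ Set.Icc 0 lam, rate α lam g (Function.update x i u) *
        φ (Function.update x i u) = rate α lam g x * φ x := by
      intro u hu
      rw [hφi x u hω hu.2, rate_update hω hu.2]
    refine (setIntegral_congr_fun measurableSet_Icc e1).trans
      (Eq.trans ?_ (setIntegral_congr_fun measurableSet_Icc e2).symm)
    -- The average is threshold times `R⁻¹ φ`, and the threshold is `lam · rate · R`, with `R`
    -- evaluated at entry `i` put to `0`.
    refine (hax.integral_rejected hα hlam0 hω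
      (fun (_ : ℝ) (n : ℕ) => (n : ℝ)⁻¹ * φ x)).trans ?_
    rw [setIntegral_Icc_const hlam0,
      hax.threshold_update_eq hα hlam0 hω]
    have := hax.rejections_update_ne_zero hα hlam0 hω
    field_simp

lemma FDP_eq_sum_indLE (α lam : ℝ) (g : (Set.Ici lam → ℝ) → ℝ) (I₀ : Finset (Fin m))
    (x : Fin m → ℝ) : FDP α lam g I₀ x = ∑ i ∈ I₀, indLE lam (x i) *
      (indLE (threshold α lam g x) (x i) * (rejections α lam g x : ℝ)⁻¹) := by
  rw [FDP_eq_sum]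
  refine Finset.sum_congr rfl fun i _ => ?_
  rw [← mul_assoc, indLE_mul_indLE_threshold, div_eq_mul_inv]

/-- The characteristic property of a conditional expectation, tested on functions `φ` blind to where
below `lam` a true null entry lies. Taking `φ = 1` gives the mean, and `φ = condFDP` gives
orthogonality. -/
lemma BasicIndependence.integral_FDP_mul (h : BasicIndependence P I₀ p) (hα : 0 < α)
    (hlam0 : 0 < lam) (hlam1 : lam < 1) (hg : Measurable g)
    (hadm : ∀ ω, Admissible α lam g fun j => p j ω) {φ : (Fin m → ℝ) → ℝ} (hφ : Measurable φ)
    (hφb : ∀ ω, |φ fun j => p j ω| ≤ 1)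
    (hφi : ∀ i ∈ I₀, ∀ x u, x i ≤ lam → u ≤ lam → φ (Function.update x i u) = φ x) :
    ∫ ω, FDP α lam g I₀ (fun j => p j ω) * φ (fun j => p j ω) ∂P =
      ∫ ω, condFDP α lam g I₀ (fun j => p j ω) * φ (fun j => p j ω) ∂P := by
  have e1 : ∀ x : Fin m → ℝ, FDP α lam g I₀ x * φ x = ∑ i ∈ I₀, indLE lam (x i) *
      (indLE (threshold α lam g x) (x i) * (rejections α lam g x : ℝ)⁻¹ * φ x) := by
    intro x
    rw [FDP_eq_sum_indLE, Finset.sum_mul]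
    exact Finset.sum_congr rfl fun i _ => by ring
  have e2 : ∀ x : Fin m → ℝ, condFDP α lam g I₀ x * φ x = ∑ i ∈ I₀, indLE lam (x i) *
      (rate α lam g x * φ x) := by
    intro x
    rw [condFDP, nullCnt, Finset.sum_mul, Finset.sum_mul]
    exact Finset.sum_congr rfl fun i _ => by ring
  simp only [e1, e2]
  rw [integral_finsetSum, integral_finsetSum]
  · exact Finset.sum_congr rfl fun i hi =>
      h.integral_rejected_mul hα hlam0 hlam1 hg hadm hφ hφb hi (hφi i hi)
  · intro i _
    refine h.integrable_of_bound (f := fun x => indLE lam (x i) * (rate α lam g x * φ x))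
      ((measurable_indLE_apply lam i).mul ((measurable_rate hg).mul hφ)) (C := 1) fun ω => ?_
    simp only
    rw [← mul_assoc]
    exact abs_mul_le_one ((hadm ω).indLE_mul_rate hα hlam0 i) (hφb ω)
  · intro i _
    refine h.integrable_of_bound (f := fun x => indLE lam (x i) *
      (indLE (threshold α lam g x) (x i) * (rejections α lam g x : ℝ)⁻¹ * φ x))
      ((measurable_indLE_apply lam i).mul (((measurable_indLE_threshold hg i).mul
        (measurable_inv_rejections hg)).mul hφ)) (C := 1) fun ω => ?_
    exact abs_mul_le_one (abs_indLE_le_one _ _) (abs_mul_le_one (abs_mul_le_one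
      (abs_indLE_le_one _ _) (abs_inv_natCast_le_one _)) (hφb ω))

/-- Joint rejection of a true null `i` and an entry `j ≠ i`: average over the coordinate `i`. -/
lemma BasicIndependence.integral_rejected_mul_of_ne (h : BasicIndependence P I₀ p) (hα : 0 < α)
    (hlam0 : 0 < lam) (hlam1 : lam < 1) (hg : Measurable g)
    (hadm : ∀ ω, Admissible α lam g fun j => p j ω) {i j : Fin m} (hi : i ∈ I₀) (hj : j ∈ I₀)
    (hij : i ≠ j) :
    ∫ ω, indLE lam (p i ω) * (indLE (threshold α lam g fun j => p j ω) (p i ω) *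
        (indLE (threshold α lam g fun j => p j ω) (p j ω) *
          ((rejections α lam g fun j => p j ω : ℝ)⁻¹) ^ 2)) ∂P =
      ∫ ω, indLE lam (p i ω) * indLE lam (p j ω) * rate α lam g (fun j => p j ω) ^ 2 ∂P := by
  set F : (Fin m → ℝ) → ℝ := fun x =>
    indLE (threshold α lam g x) (x j) * (rejections α lam g x : ℝ)⁻¹ with hF
  have hFm : Measurable F := (measurable_indLE_threshold hg j).mul (measurable_inv_rejections hg)
  have hFb : ∀ x, |F x| ≤ 1 := fun x =>
    abs_mul_le_one (abs_indLE_le_one _ _) (abs_inv_natCast_le_one _)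
  have hindi := measurable_indLE_apply (m := m) lam i
  have hindj := measurable_indLE_apply (m := m) lam j
  have hFi : Measurable fun x => F (Function.update x i 0) := hFm.comp (measurable_update_zero i)
  have hrate := measurable_rate (m := m) (α := α) hg
  have hf1 : Measurable fun x : Fin m → ℝ => indLE (threshold α lam g x) (x i) *
        (indLE (threshold α lam g x) (x j) * ((rejections α lam g x : ℝ)⁻¹) ^ 2) :=
    (measurable_indLE_threshold hg i).mul ((measurable_indLE_threshold hg j).mul
      ((measurable_inv_rejections hg).pow_const 2))
  -- Averaging over `i` cancels one of the two factors `R⁻¹` and leaves `F` at the vector with entry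
  -- `i` put to `0`.
  have step1 : ∫ ω, indLE lam (p i ω) * (indLE (threshold α lam g fun j => p j ω) (p i ω) *
        (indLE (threshold α lam g fun j => p j ω) (p j ω) *
          ((rejections α lam g fun j => p j ω : ℝ)⁻¹) ^ 2)) ∂P =
      ∫ ω, indLE lam (p i ω) * (rate α lam g (fun j => p j ω) *
        F (Function.update (fun j => p j ω) i 0)) ∂P := by
    refine h.integral_congr_of_average hi hlam0 hlam1 hf1 (hrate.mul hFi)
      (h.integrable_of_bound (hindi.mul hf1) (C := 1) fun ω => ?_)
      (h.integrable_of_bound (hindi.mul (hrate.mul hFi)) (C := 1) fun ω => ?_) fun ω hω => ?_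
    · refine abs_mul_le_one (abs_indLE_le_one _ _) (abs_mul_le_one
        (abs_indLE_le_one _ _) (abs_mul_le_one (abs_indLE_le_one _ _) ?_))
      rw [sq]
      exact abs_mul_le_one (abs_inv_natCast_le_one _) (abs_inv_natCast_le_one _)
    · simp only [Pi.mul_apply]
      rw [← mul_assoc]
      exact abs_mul_le_one ((hadm ω).indLE_mul_rate hα hlam0 i) (hFb _)
    · set x : Fin m → ℝ := fun j => p j ω
      have hax : Admissible α lam g x := hadm ω
      have e1 : ∀ u ∈ Set.Icc 0 lam, indLE (threshold α lam g (Function.update x i u))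
          (Function.update x i u i) * (indLE (threshold α lam g (Function.update x i u))
          (Function.update x i u j) * ((rejections α lam g (Function.update x i u) : ℝ)⁻¹) ^ 2) =
          indLE (threshold α lam g (Function.update x i u)) u *
            (fun (t : ℝ) (n : ℕ) => indLE t (x j) * ((n : ℝ)⁻¹) ^ 2)
              (threshold α lam g (Function.update x i u))
              (rejections α lam g (Function.update x i u)) := by
        intro u hu
        simp only [Function.update_self, Function.update_of_ne hij.symm]
      have e2 : ∀ u ∈ Set.Icc 0 lam, (rate α lam g (Function.update x i u) *
          F (Function.update (Function.update x i u) i 0)) =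
          rate α lam g x * F (Function.update x i 0) := by
        intro u hu
        rw [rate_update hω hu.2, Function.update_idem]
      refine (setIntegral_congr_fun measurableSet_Icc e1).trans
        (Eq.trans ?_ (setIntegral_congr_fun measurableSet_Icc e2).symm)
      refine (hax.integral_rejected hα hlam0 hω
        (fun (t : ℝ) (n : ℕ) => indLE t (x j) * ((n : ℝ)⁻¹) ^ 2)).trans ?_
      rw [setIntegral_Icc_const hlam0,
        hax.threshold_update_eq hα hlam0 hω]
      have := hax.rejections_update_ne_zero hα hlam0 hω
      simp only [hF, Function.update_of_ne hij.symm,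
        ← hax.threshold_update_eq hα hlam0 hω]
      field_simp
      rw [hax.threshold_update_eq hα hlam0 hω]
      ring
  have hg1 : Measurable fun x : Fin m → ℝ => indLE lam (x i) * rate α lam g x *
      F (Function.update x i 0) := (hindi.mul hrate).mul hFi
  have hg2 : Measurable fun x : Fin m → ℝ => indLE lam (x i) * rate α lam g x *
      rate α lam g x := (hindi.mul hrate).mul hrate
  -- Averaging over `j`, with entry `i` already at `0`, cancels the remaining `R⁻¹` and yields the
  -- second factor `rate`.
  have step2 : ∫ ω, indLE lam (p j ω) * (indLE lam (p i ω) * rate α lam g (fun j => p j ω) *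
        F (Function.update (fun j => p j ω) i 0)) ∂P =
      ∫ ω, indLE lam (p j ω) * (indLE lam (p i ω) * rate α lam g (fun j => p j ω) *
        rate α lam g (fun j => p j ω)) ∂P := by
    refine h.integral_congr_of_average hj hlam0 hlam1 hg1 hg2
      (h.integrable_of_bound (hindj.mul hg1) (C := 1) fun ω => ?_)
      (h.integrable_of_bound (hindj.mul hg2) (C := 1) fun ω => ?_) fun ω hω => ?_
    · exact abs_mul_le_one (abs_indLE_le_one _ _)
        (abs_mul_le_one ((hadm ω).indLE_mul_rate hα hlam0 i) (hFb _))
    · have e : ∀ a b c : ℝ, a * (b * c * c) = (b * c) * (a * c) := fun a b c => by ring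
      simp only [Pi.mul_apply]
      rw [e]
      exact abs_mul_le_one ((hadm ω).indLE_mul_rate hα hlam0 i)
        ((hadm ω).indLE_mul_rate hα hlam0 j)
    · set x : Fin m → ℝ := fun j => p j ω
      have hax : Admissible α lam g x := hadm ω
      by_cases hxi : x i ≤ lam
      · have hadm' := hax.update hxi le_rfl hlam0.le
        have hω' : Function.update x i 0 j ≤ lam := by
          rwa [Function.update_of_ne hij.symm]
        have e1 : ∀ u ∈ Set.Icc 0 lam, indLE lam (Function.update x j u i) *
            rate α lam g (Function.update x j u) *
              F (Function.update (Function.update x j u) i 0) =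
            indLE (threshold α lam g (Function.update (Function.update x i 0) j u)) u *
              (fun (_ : ℝ) (n : ℕ) => (n : ℝ)⁻¹ * rate α lam g x)
                (threshold α lam g (Function.update (Function.update x i 0) j u))
                (rejections α lam g (Function.update (Function.update x i 0) j u)) := by
          intro u hu
          rw [Function.update_comm hij.symm, rate_update hω hu.2, indLE_update hω hu.2]
          simp only [hF, Function.update_self]
          rw [indLE, if_pos hxi]
          ring
        have e2 : ∀ u ∈ Set.Icc 0 lam, indLE lam (Function.update x j u i) *
            rate α lam g (Function.update x j u) * rate α lam g (Function.update x j u) =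
            rate α lam g x * rate α lam g x := by
          intro u hu
          rw [rate_update hω hu.2, indLE_update hω hu.2, indLE, if_pos hxi, one_mul]
        refine (setIntegral_congr_fun measurableSet_Icc e1).trans
          (Eq.trans ?_ (setIntegral_congr_fun measurableSet_Icc e2).symm)
        refine (hadm'.integral_rejected hα hlam0 hω'
          (fun (_ : ℝ) (n : ℕ) => (n : ℝ)⁻¹ * rate α lam g x)).trans ?_
        rw [setIntegral_Icc_const hlam0,
          hadm'.threshold_update_eq hα hlam0 hω', rate_update hxi hlam0.le]
        have := hadm'.rejections_update_ne_zero hα hlam0 hω'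
        field_simp
      · have : ∀ u, indLE lam (Function.update x j u i) = 0 := by
          intro u
          rw [Function.update_of_ne hij, indLE, if_neg hxi]
        simp only [this, zero_mul]
  rw [step1]
  refine Eq.trans ?_ (step2.trans ?_)
  · refine integral_congr_ae (ae_of_all _ fun ω => ?_)
    set x : Fin m → ℝ := fun j => p j ω with hx
    have : F (Function.update x i 0) = indLE lam (p j ω) * F (Function.update x i 0) := by
      simp only [hF, Function.update_of_ne hij.symm, hx]
      rw [← mul_assoc, indLE_mul_indLE_threshold]
    simp only
    conv_lhs => rw [this]
    ring
  · exact integral_congr_ae (ae_of_all _ fun ω => by simp only; ring)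

/-- On the diagonal there is one average for two factors `R⁻¹`, so one of them survives. This is how
the number of rejections enters the variance. -/
lemma BasicIndependence.integral_rejected_self (h : BasicIndependence P I₀ p) (hα : 0 < α)
    (hlam0 : 0 < lam) (hlam1 : lam < 1) (hg : Measurable g)
    (hadm : ∀ ω, Admissible α lam g fun j => p j ω) {i : Fin m} (hi : i ∈ I₀) :
    ∫ ω, indLE lam (p i ω) * (indLE (threshold α lam g fun j => p j ω) (p i ω) *
          ((rejections α lam g fun j => p j ω : ℝ)⁻¹) ^ 2) ∂P =
      ∫ ω, indLE lam (p i ω) * (rate α lam g (fun j => p j ω) *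
        (rejections α lam g (Function.update (fun j => p j ω) i 0) : ℝ)⁻¹) ∂P := by
  have hindi := measurable_indLE_apply (m := m) lam i
  have hf1 : Measurable fun x : Fin m → ℝ => indLE (threshold α lam g x) (x i) *
        ((rejections α lam g x : ℝ)⁻¹) ^ 2 :=
    (measurable_indLE_threshold hg i).mul ((measurable_inv_rejections hg).pow_const 2)
  have hf2 : Measurable fun x : Fin m → ℝ => rate α lam g x *
      (rejections α lam g (Function.update x i 0) : ℝ)⁻¹ :=
    (measurable_rate hg).mul ((measurable_inv_rejections hg).comp (measurable_update_zero i))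
  refine h.integral_congr_of_average hi hlam0 hlam1 hf1 hf2
    (h.integrable_of_bound (hindi.mul hf1) (C := 1) fun ω => ?_)
    (h.integrable_of_bound (hindi.mul hf2) (C := 1) fun ω => ?_) fun ω hω => ?_
  · refine abs_mul_le_one (abs_indLE_le_one _ _) (abs_mul_le_one (abs_indLE_le_one _ _) ?_)
    rw [sq]
    exact abs_mul_le_one (abs_inv_natCast_le_one _) (abs_inv_natCast_le_one _)
  · simp only [Pi.mul_apply]
    rw [← mul_assoc]
    exact abs_mul_le_one ((hadm ω).indLE_mul_rate hα hlam0 i) (abs_inv_natCast_le_one _)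
  · set x : Fin m → ℝ := fun j => p j ω
    have hax : Admissible α lam g x := hadm ω
    have e1 : ∀ u ∈ Set.Icc 0 lam, indLE (threshold α lam g (Function.update x i u))
        (Function.update x i u i) * ((rejections α lam g (Function.update x i u) : ℝ)⁻¹) ^ 2 =
        indLE (threshold α lam g (Function.update x i u)) u *
          (fun (_ : ℝ) (n : ℕ) => ((n : ℝ)⁻¹) ^ 2)
            (threshold α lam g (Function.update x i u))
            (rejections α lam g (Function.update x i u)) := by
      intro u hu
      simp only [Function.update_self]
    have e2 : ∀ u ∈ Set.Icc 0 lam, (rate α lam g (Function.update x i u) *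
        (rejections α lam g (Function.update (Function.update x i u) i 0) : ℝ)⁻¹) =
        rate α lam g x * (rejections α lam g (Function.update x i 0) : ℝ)⁻¹ := by
      intro u hu
      rw [rate_update hω hu.2, Function.update_idem]
    refine (setIntegral_congr_fun measurableSet_Icc e1).trans
      (Eq.trans ?_ (setIntegral_congr_fun measurableSet_Icc e2).symm)
    refine (hax.integral_rejected hα hlam0 hω
      (fun (_ : ℝ) (n : ℕ) => ((n : ℝ)⁻¹) ^ 2)).trans ?_
    rw [setIntegral_Icc_const hlam0,
      hax.threshold_update_eq hα hlam0 hω]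
    have := hax.rejections_update_ne_zero hα hlam0 hω
    field_simp

/-- Exchangeability: which of two true nulls below `lam` is replaced by `0` is irrelevant in
expectation. -/
lemma BasicIndependence.integral_exchange (h : BasicIndependence P I₀ p) (hα : 0 < α)
    (hlam0 : 0 < lam) (hlam1 : lam < 1) (hg : Measurable g)
    (hadm : ∀ ω, Admissible α lam g fun j => p j ω) {i k : Fin m} (hi : i ∈ I₀) (hk : k ∈ I₀) :
    ∫ ω, indLE lam (p i ω) * (firstInd lam I₀ k (fun j => p j ω) * rate α lam g (fun j => p j ω) *
        (rejections α lam g (Function.update (fun j => p j ω) i 0) : ℝ)⁻¹) ∂P =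
      ∫ ω, indLE lam (p i ω) * (firstInd lam I₀ k (fun j => p j ω) *
        rate α lam g (fun j => p j ω) *
        (rejections α lam g (Function.update (fun j => p j ω) k 0) : ℝ)⁻¹) ∂P := by
  rcases eq_or_ne i k with rfl | hik
  · rfl
  -- `firstInd` already forces `x k ≤ lam`, so both integrands carry both indicators and either
  -- coordinate can be resampled.
  have hfirst : ∀ x : Fin m → ℝ, indLE lam (x k) * firstInd lam I₀ k x = firstInd lam I₀ k x := by
    intro x
    unfold indLE firstInd
    by_cases hx : x k ≤ lam <;> simp [hx]
  have hfm := measurable_firstInd (lam := lam) (I₀ := I₀) k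
  have hrate := measurable_rate (m := m) (α := α) hg
  have hR : ∀ l : Fin m, Measurable fun x : Fin m → ℝ =>
      (rejections α lam g (Function.update x l 0) : ℝ)⁻¹ := fun l =>
    (measurable_inv_rejections hg).comp (measurable_update_zero l)
  have hf1 : Measurable fun x : Fin m → ℝ => indLE lam (x i) * (firstInd lam I₀ k x *
      rate α lam g x * (rejections α lam g (Function.update x i 0) : ℝ)⁻¹) :=
    (measurable_indLE_apply lam i).mul ((hfm.mul hrate).mul (hR i))
  have hf2 : Measurable fun x : Fin m → ℝ => indLE lam (x k) * (firstInd lam I₀ k x *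
      rate α lam g x * (rejections α lam g (Function.update x k 0) : ℝ)⁻¹) :=
    (measurable_indLE_apply lam k).mul ((hfm.mul hrate).mul (hR k))
  have hb : ∀ ω (i k l : Fin m) (n : ℕ), |indLE lam (p i ω) * (indLE lam (p k ω) *
      (firstInd lam I₀ l (fun j => p j ω) * rate α lam g (fun j => p j ω) * (n : ℝ)⁻¹))| ≤ 1 := by
    intro ω i k l n
    -- The rate is bounded only together with an indicator, hence the regrouping.
    have e : ∀ a b c d f : ℝ, a * (b * (c * d * f)) = a * ((b * d) * (c * f)) := by
      intros; ring
    rw [e]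
    exact abs_mul_le_one (abs_indLE_le_one _ _) (abs_mul_le_one
      ((hadm ω).indLE_mul_rate hα hlam0 k) (abs_mul_le_one (abs_firstInd_le_one _ _ _ _)
        (abs_inv_natCast_le_one _)))
  have s1 := h.integral_resample hk hlam0 hlam1 hf1
    (h.integrable_of_bound ((measurable_indLE_apply lam k).mul hf1) (C := 1) fun ω => hb ω k i k _)
  have s2 := h.integral_resample hi hlam0 hlam1 hf2
    (h.integrable_of_bound ((measurable_indLE_apply lam i).mul hf2) (C := 1) fun ω => hb ω i k k _)
  have e1 : ∀ ω, indLE lam (p i ω) * (firstInd lam I₀ k (fun j => p j ω) *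
        rate α lam g (fun j => p j ω) *
        (rejections α lam g (Function.update (fun j => p j ω) i 0) : ℝ)⁻¹) =
      (if p k ω ≤ lam then (1 : ℝ) else 0) * (indLE lam (p i ω) *
        (firstInd lam I₀ k (fun j => p j ω) * rate α lam g (fun j => p j ω) *
        (rejections α lam g (Function.update (fun j => p j ω) i 0) : ℝ)⁻¹)) := by
    intro ω
    have := hfirst fun j => p j ω
    unfold indLE at this ⊢
    conv_lhs => rw [← this]
    ring
  have e2 : ∀ ω, indLE lam (p i ω) * (firstInd lam I₀ k (fun j => p j ω) *
        rate α lam g (fun j => p j ω) *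
        (rejections α lam g (Function.update (fun j => p j ω) k 0) : ℝ)⁻¹) =
      (if p i ω ≤ lam then (1 : ℝ) else 0) * (indLE lam (p k ω) *
        (firstInd lam I₀ k (fun j => p j ω) * rate α lam g (fun j => p j ω) *
        (rejections α lam g (Function.update (fun j => p j ω) k 0) : ℝ)⁻¹)) := by
    intro ω
    have := hfirst fun j => p j ω
    unfold indLE at this ⊢
    conv_lhs => rw [← this]
    ring
  rw [integral_congr_ae (ae_of_all _ e1), integral_congr_ae (ae_of_all _ e2)]
  refine s1.trans (Eq.trans ?_ s2.symm)
  congr 2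
  funext ω
  set x : Fin m → ℝ := fun j => p j ω with hx
  by_cases hxk : x k ≤ lam
  · by_cases hxi : x i ≤ lam
    · rw [if_pos hxk, if_pos hxi]
      congr 1
      refine setIntegral_congr_fun measurableSet_Icc fun u hu => ?_
      -- With `k` resampled on the left and `i` on the right, the vectors carry `0` and `u` in slots
      -- `i` and `k` in opposite order; all other factors are unaffected by these moves.
      rw [indLE_update hxk hu.2, indLE_update hxi hu.2, firstInd_update hxk hu.2,
        firstInd_update hxi hu.2, rate_update hxk hu.2, rate_update hxi hu.2,
        Function.update_comm hik.symm, rejections_update_swap α lam g x hik,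
        Function.update_comm hik, indLE, if_pos hxi, indLE, if_pos hxk]
    · rw [if_neg hxi]
      simp [Function.update_of_ne hik, indLE, hxi]
  · rw [if_neg hxk]
    simp [Function.update_of_ne hik.symm, indLE, hxk]

end moments

/-! ### Variance decomposition of the false discovery proportion -/

section variance

variable {Ω : Type*} [MeasurableSpace Ω] {P : Measure Ω} [IsProbabilityMeasure P]
  {I₀ : Finset (Fin m)} {p : Fin m → Ω → ℝ} {α lam : ℝ} {g : (Set.Ici lam → ℝ) → ℝ}

lemma abs_condFDP_le_one {x : Fin m → ℝ} (h : Admissible α lam g x) (hα : 0 < α)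
    (hlam : 0 < lam) : |condFDP α lam g I₀ x| ≤ 1 := by
  rw [abs_of_nonneg (condFDP_nonneg h hα hlam)]
  exact condFDP_le_one h hα hlam

lemma FDP_nonneg (α lam : ℝ) (g : (Set.Ici lam → ℝ) → ℝ) (I₀ : Finset (Fin m)) (x : Fin m → ℝ) :
    0 ≤ FDP α lam g I₀ x := by unfold FDP; positivity

lemma abs_FDP_le_one {x : Fin m → ℝ} (h : Admissible α lam g x) (hα : 0 < α) :
    |FDP α lam g I₀ x| ≤ 1 := by
  rw [abs_of_nonneg (FDP_nonneg _ _ _ _ _)]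
  refine div_le_one_of_le₀ ?_ (by positivity)
  rw [← h.cnt_threshold hα]
  exact_mod_cast Finset.card_le_card (Finset.filter_subset_filter _ (Finset.subset_univ _))

lemma BasicIndependence.integrable_condFDP_div (h : BasicIndependence P I₀ p) (hα : 0 < α)
    (hlam0 : 0 < lam) (hg : Measurable g) (hadm : ∀ ω, Admissible α lam g fun j => p j ω) :
    Integrable (fun ω => condFDP α lam g I₀ (fun j => p j ω) /
      rejectionsOne α lam g I₀ (fun j => p j ω)) P := by
  refine h.integrable_of_bound
    (f := fun x => condFDP α lam g I₀ x / rejectionsOne α lam g I₀ x) ?_ (C := 1) fun ω => ?_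
  · simp only [condFDP_div_rejectionsOne]
    exact Finset.measurable_sum _ fun i _ => Finset.measurable_sum _ fun k _ =>
      (measurable_indLE_apply lam i).mul (((measurable_firstInd k).mul (measurable_rate hg)).mul
        ((measurable_inv_rejections hg).comp (measurable_update_zero k)))
  · simp only [div_eq_mul_inv]
    exact abs_mul_le_one (abs_condFDP_le_one (hadm ω) hα hlam0) (abs_inv_natCast_le_one _)

/-- Collects the diagonal terms, each with its own entry put to `0`, into the single quantity
`rejectionsOne`: insert `∑ k, firstInd = 1`, exchange `i` for `k`, and sum again. -/
lemma BasicIndependence.integral_sum_inv_rejections (h : BasicIndependence P I₀ p) (hα : 0 < α)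
    (hlam0 : 0 < lam) (hlam1 : lam < 1) (hg : Measurable g)
    (hadm : ∀ ω, Admissible α lam g fun j => p j ω) :
    ∑ i ∈ I₀, ∫ ω, indLE lam (p i ω) * (rate α lam g (fun j => p j ω) *
        (rejections α lam g (Function.update (fun j => p j ω) i 0) : ℝ)⁻¹) ∂P =
      ∫ ω, condFDP α lam g I₀ (fun j => p j ω) /
        rejectionsOne α lam g I₀ (fun j => p j ω) ∂P := by
  have hint : ∀ i k l : Fin m, Integrable (fun ω => indLE lam (p i ω) *
      (firstInd lam I₀ k (fun j => p j ω) * rate α lam g (fun j => p j ω) *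
        (rejections α lam g (Function.update (fun j => p j ω) l 0) : ℝ)⁻¹)) P := by
    intro i k l
    refine h.integrable_of_bound (f := fun x => indLE lam (x i) *
      (firstInd lam I₀ k x * rate α lam g x * (rejections α lam g (Function.update x l 0) : ℝ)⁻¹))
      ((measurable_indLE_apply lam i).mul (((measurable_firstInd k).mul (measurable_rate hg)).mul
        ((measurable_inv_rejections hg).comp (measurable_update_zero l)))) (C := 1) fun ω => ?_
    have e : ∀ a b c d : ℝ, a * (b * c * d) = (a * c) * (b * d) := by intros; ring
    simp only
    rw [e]
    exact abs_mul_le_one ((hadm ω).indLE_mul_rate hα hlam0 i)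
      (abs_mul_le_one (abs_firstInd_le_one _ _ _ _) (abs_inv_natCast_le_one _))
  simp only [condFDP_div_rejectionsOne]
  rw [integral_finsetSum _ fun i _ => integrable_finsetSum _ fun k _ => hint i k k]
  refine Finset.sum_congr rfl fun i hi => ?_
  rw [integral_finsetSum _ fun k _ => hint i k k]
  refine Eq.trans ?_ (Finset.sum_congr rfl fun k hk =>
    h.integral_exchange hα hlam0 hlam1 hg hadm hi hk)
  rw [← integral_finsetSum _ fun k _ => hint i k i]
  refine integral_congr_ae (ae_of_all _ fun ω => ?_)
  have := sum_firstInd (lam := lam) (x := fun j => p j ω) hi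
  simp only at this ⊢
  conv_lhs => rw [← this]
  rw [Finset.mul_sum, Finset.sum_mul]
  exact Finset.sum_congr rfl fun k _ => by ring

/-- Expand both squares as double sums over true nulls. Off-diagonal expectations agree exactly; the
last two terms replace the diagonal of `condFDP ^ 2` by that of `FDP ^ 2`. -/
lemma BasicIndependence.integral_FDP_sq (h : BasicIndependence P I₀ p) (hα : 0 < α)
    (hlam0 : 0 < lam) (hlam1 : lam < 1) (hg : Measurable g)
    (hadm : ∀ ω, Admissible α lam g fun j => p j ω) :
    ∫ ω, FDP α lam g I₀ (fun j => p j ω) ^ 2 ∂P =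
      ∫ ω, condFDP α lam g I₀ (fun j => p j ω) ^ 2 ∂P +
      ∫ ω, condFDP α lam g I₀ (fun j => p j ω) /
        rejectionsOne α lam g I₀ (fun j => p j ω) ∂P -
      ∫ ω, nullCnt lam I₀ (fun j => p j ω) * rate α lam g (fun j => p j ω) ^ 2 ∂P := by
  have hA : ∀ i j : Fin m, Integrable (fun ω => indLE lam (p i ω) *
      (indLE (threshold α lam g fun j => p j ω) (p i ω) *
        (indLE (threshold α lam g fun j => p j ω) (p j ω) *
          ((rejections α lam g fun j => p j ω : ℝ)⁻¹) ^ 2))) P := by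
    intro i j
    refine h.integrable_of_bound (f := fun x => indLE lam (x i) *
      (indLE (threshold α lam g x) (x i) * (indLE (threshold α lam g x) (x j) * ((rejections α lam g x : ℝ)⁻¹) ^ 2)))
      ((measurable_indLE_apply lam i).mul ((measurable_indLE_threshold hg i).mul
        ((measurable_indLE_threshold hg j).mul ((measurable_inv_rejections hg).pow_const 2))))
      (C := 1) fun ω => ?_
    refine abs_mul_le_one (abs_indLE_le_one _ _) (abs_mul_le_one
        (abs_indLE_le_one _ _) (abs_mul_le_one (abs_indLE_le_one _ _) ?_))
    rw [sq]
    exact abs_mul_le_one (abs_inv_natCast_le_one _) (abs_inv_natCast_le_one _)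
  have hB : ∀ i j : Fin m, Integrable (fun ω => indLE lam (p i ω) * indLE lam (p j ω) *
      rate α lam g (fun j => p j ω) ^ 2) P := by
    intro i j
    refine h.integrable_of_bound (f := fun x => indLE lam (x i) * indLE lam (x j) *
      rate α lam g x ^ 2) (((measurable_indLE_apply lam i).mul (measurable_indLE_apply lam j)).mul
        ((measurable_rate hg).pow_const 2)) (C := 1) fun ω => ?_
    have e : ∀ a b c : ℝ, a * b * c ^ 2 = (a * c) * (b * c) := by intros; ring
    simp only
    rw [e]
    exact abs_mul_le_one ((hadm ω).indLE_mul_rate hα hlam0 i) ((hadm ω).indLE_mul_rate hα hlam0 j)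
  have hself : ∀ t u : ℝ, indLE t u * indLE t u = indLE t u := by
    intro t u; unfold indLE; split_ifs <;> simp
  have e1 : ∀ x : Fin m → ℝ, FDP α lam g I₀ x ^ 2 = ∑ i ∈ I₀, ∑ j ∈ I₀, indLE lam (x i) *
      (indLE (threshold α lam g x) (x i) * (indLE (threshold α lam g x) (x j) *
        ((rejections α lam g x : ℝ)⁻¹) ^ 2)) := by
    intro x
    rw [sq]
    nth_rewrite 1 [FDP_eq_sum_indLE]
    rw [FDP_eq_sum, Finset.sum_mul_sum]
    refine Finset.sum_congr rfl fun i _ => Finset.sum_congr rfl fun j _ => ?_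
    rw [div_eq_mul_inv]
    ring
  have e2 : ∀ x : Fin m → ℝ, condFDP α lam g I₀ x ^ 2 = ∑ i ∈ I₀, ∑ j ∈ I₀,
      indLE lam (x i) * indLE lam (x j) * rate α lam g x ^ 2 := by
    intro x
    rw [condFDP, mul_pow, sq (nullCnt lam I₀ x), nullCnt, Finset.sum_mul_sum, Finset.sum_mul]
    exact Finset.sum_congr rfl fun i _ => Finset.sum_mul _ _ _
  have e3 : ∀ x : Fin m → ℝ, nullCnt lam I₀ x * rate α lam g x ^ 2 = ∑ i ∈ I₀,
      indLE lam (x i) * indLE lam (x i) * rate α lam g x ^ 2 := by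
    intro x
    rw [nullCnt, Finset.sum_mul]
    exact Finset.sum_congr rfl fun i _ => by rw [hself]
  rw [← h.integral_sum_inv_rejections hα hlam0 hlam1 hg hadm]
  simp only [e1, e2, e3]
  rw [integral_finsetSum _ fun i _ => integrable_finsetSum _ fun j _ => hA i j,
    integral_finsetSum _ fun i _ => integrable_finsetSum _ fun j _ => hB i j,
    integral_finsetSum _ fun i _ => hB i i, ← Finset.sum_add_distrib, ← Finset.sum_sub_distrib]
  refine Finset.sum_congr rfl fun i hi => ?_
  rw [integral_finsetSum _ fun j _ => hA i j, integral_finsetSum _ fun j _ => hB i j,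
    ← Finset.add_sum_erase _ _ hi, ← Finset.add_sum_erase I₀ (fun j => ∫ ω, indLE lam (p i ω) *
      indLE lam (p j ω) * rate α lam g (fun j => p j ω) ^ 2 ∂P) hi,
    Finset.sum_congr rfl fun j hj => h.integral_rejected_mul_of_ne hα hlam0 hlam1 hg hadm hi
      (Finset.mem_of_mem_erase hj) (Finset.ne_of_mem_erase hj).symm]
  have : ∫ ω, indLE lam (p i ω) * (indLE (threshold α lam g fun j => p j ω) (p i ω) *
        (indLE (threshold α lam g fun j => p j ω) (p i ω) *
          ((rejections α lam g fun j => p j ω : ℝ)⁻¹) ^ 2)) ∂P =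
      ∫ ω, indLE lam (p i ω) * (rate α lam g (fun j => p j ω) *
        (rejections α lam g (Function.update (fun j => p j ω) i 0) : ℝ)⁻¹) ∂P := by
    rw [← h.integral_rejected_self hα hlam0 hlam1 hg hadm hi]
    refine integral_congr_ae (ae_of_all _ fun ω => ?_)
    simp only
    rw [← mul_assoc (indLE _ (p i ω)) (indLE _ (p i ω)) (_ ^ 2), hself]
  rw [this]
  ring

lemma integral_sub_mul_add {Ω : Type*} [MeasurableSpace Ω] {P : Measure Ω} {A B C : Ω → ℝ}
    (hA : Integrable A P) (hB : Integrable B P) (hC : Integrable C P) (r : ℝ) :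
    ∫ ω, (A ω - r * B ω + C ω) ∂P = ∫ ω, A ω ∂P - r * ∫ ω, B ω ∂P + ∫ ω, C ω ∂P := by
  have h1 := integral_add (hA.sub (hB.const_mul r)) hC
  have h2 := integral_sub hA (hB.const_mul r)
  rw [integral_const_mul] at h2
  rw [← h2]
  exact h1

/-- The mean squared distance of the false discovery proportion from its conditional mean. -/
lemma BasicIndependence.integral_FDP_sub_condFDP_sq (h : BasicIndependence P I₀ p) (hα : 0 < α)
    (hlam0 : 0 < lam) (hlam1 : lam < 1) (hg : Measurable g)
    (hadm : ∀ ω, Admissible α lam g fun j => p j ω) :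
    ∫ ω, (FDP α lam g I₀ (fun j => p j ω) - condFDP α lam g I₀ (fun j => p j ω)) ^ 2 ∂P =
      ∫ ω, condFDP α lam g I₀ (fun j => p j ω) /
        rejectionsOne α lam g I₀ (fun j => p j ω) ∂P -
      ∫ ω, nullCnt lam I₀ (fun j => p j ω) * rate α lam g (fun j => p j ω) ^ 2 ∂P := by
  have hX := measurable_FDP (m := m) (α := α) (I₀ := I₀) hg
  have hS := measurable_condFDP (m := m) (α := α) (I₀ := I₀) hg
  have hXb : ∀ ω, |FDP α lam g I₀ (fun j => p j ω)| ≤ 1 := fun ω => abs_FDP_le_one (hadm ω) hα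
  have hSb : ∀ ω, |condFDP α lam g I₀ (fun j => p j ω)| ≤ 1 := fun ω =>
    abs_condFDP_le_one (hadm ω) hα hlam0
  have hXX := h.integrable_of_bound (hX.mul hX) (C := 1) fun ω => abs_mul_le_one (hXb ω) (hXb ω)
  have hXS := h.integrable_of_bound (hX.mul hS) (C := 1) fun ω => abs_mul_le_one (hXb ω) (hSb ω)
  have hSS := h.integrable_of_bound (hS.mul hS) (C := 1) fun ω => abs_mul_le_one (hSb ω) (hSb ω)
  -- Orthogonality: `condFDP` is itself an admissible test function, so the mixed moment equals its
  -- second moment.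
  have key := h.integral_FDP_mul hα hlam0 hlam1 hg hadm hS hSb
    (fun i _ x u hx hu => condFDP_update hx hu)
  have hsq := h.integral_FDP_sq hα hlam0 hlam1 hg hadm
  simp only [sq] at hsq
  have : ∀ a b : ℝ, (a - b) ^ 2 = a * a - 2 * (a * b) + b * b := by intros; ring
  simp only [this]
  simp only [Pi.mul_apply] at hXX hXS hSS
  rw [integral_sub_mul_add hXX hXS hSS, key, hsq]
  simp only [sq]
  ring

/-- Variance decomposition of the false discovery proportion. -/
lemma BasicIndependence.integral_FDP_sub_const_sq (h : BasicIndependence P I₀ p) (hα : 0 < α)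
    (hlam0 : 0 < lam) (hlam1 : lam < 1) (hg : Measurable g)
    (hadm : ∀ ω, Admissible α lam g fun j => p j ω) (c : ℝ) :
    ∫ ω, (FDP α lam g I₀ (fun j => p j ω) - c) ^ 2 ∂P =
      ∫ ω, (FDP α lam g I₀ (fun j => p j ω) - condFDP α lam g I₀ (fun j => p j ω)) ^ 2 ∂P +
      ∫ ω, (condFDP α lam g I₀ (fun j => p j ω) - c) ^ 2 ∂P := by
  have hX := measurable_FDP (m := m) (α := α) (I₀ := I₀) hg
  have hS := measurable_condFDP (m := m) (α := α) (I₀ := I₀) hg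
  have hXb : ∀ ω, |FDP α lam g I₀ (fun j => p j ω)| ≤ 1 := fun ω => abs_FDP_le_one (hadm ω) hα
  have hSb : ∀ ω, |condFDP α lam g I₀ (fun j => p j ω)| ≤ 1 := fun ω =>
    abs_condFDP_le_one (hadm ω) hα hlam0
  have hX1 := h.integrable_of_bound hX hXb
  have hS1 := h.integrable_of_bound hS hSb
  have hXX := h.integrable_of_bound (hX.mul hX) (C := 1) fun ω => abs_mul_le_one (hXb ω) (hXb ω)
  have hXS := h.integrable_of_bound (hX.mul hS) (C := 1) fun ω => abs_mul_le_one (hXb ω) (hSb ω)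
  have hSS := h.integrable_of_bound (hS.mul hS) (C := 1) fun ω => abs_mul_le_one (hSb ω) (hSb ω)
  have key := h.integral_FDP_mul hα hlam0 hlam1 hg hadm hS hSb
    (fun i _ x u hx hu => condFDP_update hx hu)
  have key1 := h.integral_FDP_mul hα hlam0 hlam1 hg hadm (φ := fun _ => 1) measurable_const
    (by simp) (by simp)
  simp only [mul_one] at key1
  simp only [Pi.mul_apply] at hXX hXS hSS
  have e1 : ∀ a b : ℝ, (a - b) ^ 2 = a * a - 2 * (a * b) + b * b := by intros; ring
  have e2 : ∀ a : ℝ, (a - c) ^ 2 = a * a - (2 * c) * a + c * c := by intros; ring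
  simp only [e1 (FDP _ _ _ _ _) (condFDP _ _ _ _ _), e2]
  have hc : Integrable (fun _ : Ω => c * c) P := integrable_const _
  rw [integral_sub_mul_add hXX hXS hSS, integral_sub_mul_add hXX hX1 hc,
    integral_sub_mul_add hSS hS1 hc, key, key1]
  ring

lemma BasicIndependence.integral_FDP (h : BasicIndependence P I₀ p) (hα : 0 < α)
    (hlam0 : 0 < lam) (hlam1 : lam < 1) (hg : Measurable g)
    (hadm : ∀ ω, Admissible α lam g fun j => p j ω) :
    ∫ ω, FDP α lam g I₀ (fun j => p j ω) ∂P = ∫ ω, condFDP α lam g I₀ (fun j => p j ω) ∂P := by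
  simpa using h.integral_FDP_mul hα hlam0 hlam1 hg hadm (φ := fun _ => 1) measurable_const
    (by simp) (by simp)

end variance

/-! ### Convergence in probability along varying probability spaces -/

section convergence

variable {Ω : ℕ → Type*} [∀ m, MeasurableSpace (Ω m)] {P : ∀ m, Measure (Ω m)}

/-- A union bound, requiring no measurability. It reduces limits in probability to pointwise ε-δ
estimates. -/
lemma TendstoZeroInProb.of_lt {X₁ X₂ Y : ∀ m, Ω m → ℝ} (h₁ : TendstoZeroInProb P X₁)
    (h₂ : TendstoZeroInProb P X₂)
    (h : ∀ ε : ℝ, 0 < ε → ∃ δ : ℝ, 0 < δ ∧ ∀ᶠ m in atTop, ∀ ω,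
      |X₁ m ω| < δ → |X₂ m ω| < δ → |Y m ω| < ε) :
    TendstoZeroInProb P Y := by
  intro ε hε
  obtain ⟨δ, hδ, hev⟩ := h ε hε
  have hsum := (h₁ δ hδ).add (h₂ δ hδ)
  rw [add_zero] at hsum
  refine tendsto_of_tendsto_of_tendsto_of_le_of_le' tendsto_const_nhds hsum
    (Eventually.of_forall fun _ => zero_le) ?_
  filter_upwards [hev] with m hm
  refine (measure_mono fun ω hω => ?_).trans (measure_union_le _ _)
  by_contra hcon
  simp only [Set.mem_union, Set.mem_ofPred_eq, not_or, not_le] at hcon hω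
  exact absurd (hm ω hcon.1 hcon.2) (not_lt.2 hω)

lemma tendstoZeroInProb_const {c : ℕ → ℝ} (hc : Tendsto c atTop (𝓝 0)) :
    TendstoZeroInProb P fun m _ => c m := by
  intro ε hε
  refine tendsto_const_nhds.congr' ?_
  have := (tendsto_order.1 hc.abs).2 ε (by simpa using hε)
  filter_upwards [this] with m hm
  simp [not_le.2 hm]

lemma TendstoZeroInProb.sq_iff {X : ∀ m, Ω m → ℝ} :
    TendstoZeroInProb P (fun m ω => X m ω ^ 2) ↔ TendstoZeroInProb P X := by
  constructor <;> intro h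
  · refine h.of_lt h fun ε hε => ⟨ε ^ 2, by positivity, Eventually.of_forall fun m ω h1 _ => ?_⟩
    rw [abs_pow] at h1
    exact lt_of_pow_lt_pow_left₀ 2 hε.le h1
  · refine h.of_lt h fun ε hε => ⟨√ε, by positivity, Eventually.of_forall fun m ω h1 _ => ?_⟩
    rw [abs_pow]
    calc |X m ω| ^ 2 < √ε ^ 2 := by gcongr
      _ = ε := Real.sq_sqrt hε.le

/-- If `A B = c W` where `W` converges in probability to a positive constant and `A` is bounded
away from `0`, then `B` is asymptotically deterministic whenever `A` is. -/
lemma TendstoZeroInProb.of_mul_eq {A B W : ∀ m, Ω m → ℝ} {a : ℕ → ℝ} {c w η : ℝ} (hc : 0 < c)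
    (hw : 0 < w) (hη : 0 < η) (hW : TendstoZeroInProb P fun m ω => W m ω - w)
    (hA : TendstoZeroInProb P fun m ω => A m ω - a m)
    (hmul : ∀ᶠ m in atTop, ∀ ω, A m ω * B m ω = c * W m ω)
    (hAη : ∀ᶠ m in atTop, ∀ ω, w / 2 < W m ω → η ≤ A m ω) :
    TendstoZeroInProb P fun m ω => B m ω - c * w / max (a m) η := by
  refine hW.of_lt hA fun ε hε => ?_
  -- Sum of the Lipschitz constants of `c W / A` in `W` and in `A`, in the region where `A` and the
  -- clamped centre are at least `η`.
  set D := c / η + c * w / η ^ 2 with hD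
  have hDpos : 0 < D := by positivity
  refine ⟨min (w / 2) (ε / D), by positivity, ?_⟩
  filter_upwards [hmul, hAη] with m hm hm' ω h1 h2
  set δ := min (w / 2) (ε / D)
  have hWw : w / 2 < W m ω := by
    have := (abs_lt.1 h1).1
    have := min_le_left (w / 2) (ε / D)
    linarith
  have hAη' := hm' ω hWw
  set a' := max (a m) η
  have ha' : η ≤ a' := le_max_right _ _
  -- The centre `a m` may itself be small; raising it to `η` does not increase its distance to `A ≥
  -- η`.
  have hAa : |a' - A m ω| ≤ |A m ω - a m| := by
    rcases max_cases (a m) η with ⟨e1, e2⟩ | ⟨e1, e2⟩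
    · rw [show a' = a m from e1, abs_sub_comm]
    · rw [show a' = η from e1, abs_of_nonpos (by linarith), abs_of_nonneg (by linarith)]
      linarith
  have hApos : 0 < A m ω := hη.trans_le hAη'
  have ha'pos : 0 < a' := hη.trans_le ha'
  have hB : B m ω = c * W m ω / A m ω := by
    rw [eq_div_iff hApos.ne', mul_comm]; exact hm ω
  have e : B m ω - c * w / a' = c * (W m ω - w) / A m ω + c * w * (a' - A m ω) / (A m ω * a') := by
    rw [hB]; field_simp; ring
  have b1 : |c * (W m ω - w) / A m ω| ≤ c / η * |W m ω - w| := by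
    rw [abs_div, abs_mul, abs_of_pos hc, abs_of_pos hApos, div_mul_eq_mul_div]
    gcongr
  have b2 : |c * w * (a' - A m ω) / (A m ω * a')| ≤ c * w / η ^ 2 * |A m ω - a m| := by
    rw [abs_div, abs_mul, abs_of_pos (mul_pos hc hw), abs_of_pos (mul_pos hApos ha'pos),
      div_mul_eq_mul_div, sq]
    gcongr
  rw [e]
  calc _ ≤ _ := abs_add_le _ _
    _ ≤ c / η * |W m ω - w| + c * w / η ^ 2 * |A m ω - a m| := add_le_add b1 b2
    _ < c / η * δ + c * w / η ^ 2 * δ := by gcongr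
    _ = D * δ := by rw [hD]; ring
    _ ≤ D * (ε / D) := by gcongr; exact min_le_right _ _
    _ = ε := by field_simp

variable [∀ m, IsProbabilityMeasure (P m)]

/-- Bounded convergence by splitting at `a / 2`: the mean is at most `a / 2 + |B| · P (X ≥ a / 2)`.
-/
lemma TendstoZeroInProb.tendsto_integral {X : ∀ m, Ω m → ℝ} (h : TendstoZeroInProb P X) {B : ℝ}
    (hint : ∀ᶠ m in atTop, Integrable (X m) (P m))
    (hb : ∀ᶠ m in atTop, ∀ ω, 0 ≤ X m ω ∧ X m ω ≤ B) :
    Tendsto (fun m => ∫ ω, X m ω ∂(P m)) atTop (𝓝 0) := by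
  rw [tendsto_order]
  refine ⟨fun a ha => ?_, fun a ha => ?_⟩
  · filter_upwards [hb] with m hm
    exact ha.trans_le (integral_nonneg fun ω => (hm ω).1)
  · have hreal : Tendsto (fun m => |B| * (P m).real {ω | a / 2 ≤ |X m ω|}) atTop (𝓝 0) := by
      have := ((ENNReal.tendsto_toReal ENNReal.zero_ne_top).comp (h (a / 2)
        (by linarith))).const_mul |B|
      simpa [Measure.real] using this
    filter_upwards [hb, hint, (tendsto_order.1 hreal).2 (a / 2) (by linarith)] with m hm hi hlt
    -- `X m` is only almost everywhere measurable, so the event is replaced by a measurable hull of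
    -- the same probability.
    set t := toMeasurable (P m) {ω | a / 2 ≤ |X m ω|} with ht
    have htm : MeasurableSet t := measurableSet_toMeasurable _ _
    have hti : Integrable (t.indicator fun _ => |B|) (P m) :=
      (integrable_const |B|).indicator htm
    have hle : ∫ ω, X m ω ∂(P m) ≤ ∫ ω, (a / 2 + t.indicator (fun _ => |B|) ω) ∂(P m) := by
      refine integral_mono hi ((integrable_const _).add hti) fun ω => ?_
      by_cases hω : ω ∈ t
      · simp only [Set.indicator_of_mem hω]
        linarith [(hm ω).2, le_abs_self B]
      · simp only [Set.indicator_of_notMem hω, add_zero]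
        have : ω ∉ {ω | a / 2 ≤ |X m ω|} := fun hh => hω (subset_toMeasurable _ _ hh)
        simp only [Set.mem_ofPred_eq, not_le] at this
        exact (le_abs_self _).trans this.le
    rw [integral_add (integrable_const _) hti, integral_indicator htm] at hle
    simp only [integral_const, probReal_univ, smul_eq_mul, one_mul, MeasurableSet.univ,
      measureReal_restrict_apply, Set.univ_inter] at hle
    have : (P m).real t = (P m).real {ω | a / 2 ≤ |X m ω|} := by
      simp [Measure.real, ht, measure_toMeasurable]
    rw [this] at hle
    linarith

lemma TendstoZeroInProb.of_tendsto_integral {X : ∀ m, Ω m → ℝ}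
    (hint : ∀ᶠ m in atTop, Integrable (X m) (P m)) (hb : ∀ᶠ m in atTop, ∀ ω, 0 ≤ X m ω)
    (h : Tendsto (fun m => ∫ ω, X m ω ∂(P m)) atTop (𝓝 0)) : TendstoZeroInProb P X := by
  intro ε hε
  have hreal : Tendsto (fun m => (P m).real {ω | ε ≤ |X m ω|}) atTop (𝓝 0) := by
    have h' := h.const_mul ε⁻¹
    rw [mul_zero] at h'
    refine tendsto_of_tendsto_of_tendsto_of_le_of_le' tendsto_const_nhds h'
      (Eventually.of_forall fun _ => measureReal_nonneg) ?_
    filter_upwards [hint, hb] with m hi hm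
    have := mul_meas_ge_le_integral_of_nonneg (ae_of_all _ hm) hi ε
    simp only [abs_of_nonneg (hm _)]
    rw [inv_mul_eq_div, le_div_iff₀ hε, mul_comm]
    exact this
  have := ENNReal.tendsto_ofReal hreal
  simpa using this

/-- A uniformly bounded sequence converges to `0` in probability iff its second moments do. -/
lemma tendstoZeroInProb_iff_integral_sq {X : ∀ m, Ω m → ℝ} {B : ℝ}
    (hint : ∀ᶠ m in atTop, Integrable (fun ω => X m ω ^ 2) (P m))
    (hb : ∀ᶠ m in atTop, ∀ ω, |X m ω| ≤ B) :
    TendstoZeroInProb P X ↔ Tendsto (fun m => ∫ ω, X m ω ^ 2 ∂(P m)) atTop (𝓝 0) := by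
  rw [← TendstoZeroInProb.sq_iff]
  refine ⟨fun h => h.tendsto_integral (B := B ^ 2) hint ?_,
    TendstoZeroInProb.of_tendsto_integral hint (Eventually.of_forall fun m ω => sq_nonneg _)⟩
  filter_upwards [hb] with m hm ω
  exact ⟨sq_nonneg _, by rw [← sq_abs]; exact pow_le_pow_left₀ (abs_nonneg _) (hm ω) 2⟩

/-- A uniformly bounded sequence that converges in probability to some deterministic sequence also
converges to its expectations. -/
lemma TendstoZeroInProb.sub_integral {Y : ∀ m, Ω m → ℝ} {B : ℝ} {c : ℕ → ℝ}
    (h : TendstoZeroInProb P fun m ω => Y m ω - c m)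
    (hint : ∀ᶠ m in atTop, Integrable (Y m) (P m)) (hb : ∀ᶠ m in atTop, ∀ ω, |Y m ω| ≤ B) :
    TendstoZeroInProb P fun m ω => Y m ω - ∫ ω', Y m ω' ∂(P m) := by
  -- Projecting the centre onto `[-B, B]`, where `Y` lives, only brings it closer to `Y` and makes
  -- `Y - c'` bounded, so its mean tends to zero as well.
  set c' : ℕ → ℝ := fun m => max (-B) (min B (c m)) with hc'
  have hclamp : ∀ᶠ m in atTop, ∀ ω, |Y m ω - c' m| ≤ |Y m ω - c m| := by
    filter_upwards [hb] with m hm ω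
    obtain ⟨h1, h2⟩ := abs_le.1 (hm ω)
    simp only [hc']
    rcases max_cases (-B) (min B (c m)) with ⟨e1, e2⟩ | ⟨e1, e2⟩ <;>
      rcases min_cases B (c m) with ⟨e3, e4⟩ | ⟨e3, e4⟩ <;> rw [e1] <;> try rw [e3]
    all_goals
      rw [e3] at e2
      rcases abs_cases (Y m ω - c m) with ⟨e5, e6⟩ | ⟨e5, e6⟩ <;> rw [e5] <;>
      refine abs_le.2 ⟨by linarith, by linarith⟩
  have h' : TendstoZeroInProb P fun m ω => |Y m ω - c' m| := by
    refine h.of_lt h fun ε hε => ⟨ε, hε, ?_⟩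
    filter_upwards [hclamp] with m hm ω h1 _
    rw [abs_abs]
    exact (hm ω).trans_lt h1
  have hE := h'.tendsto_integral (B := 2 * B)
    (by filter_upwards [hint] with m hm using (hm.sub (integrable_const _)).abs)
    (by
      filter_upwards [hb] with m hm ω
      refine ⟨abs_nonneg _, ?_⟩
      obtain ⟨h1, h2⟩ := abs_le.1 (hm ω)
      have h3 : -B ≤ c' m := le_max_left _ _
      have h4 : c' m ≤ B := max_le (by linarith) (min_le_left _ _)
      exact abs_le.2 ⟨by linarith, by linarith⟩)
  have hconst : Tendsto (fun m => c' m - ∫ ω', Y m ω' ∂(P m)) atTop (𝓝 0) := by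
    refine squeeze_zero_norm' ?_ hE
    filter_upwards [hint] with m hm
    have : ∫ ω', Y m ω' ∂(P m) - c' m = ∫ ω', (Y m ω' - c' m) ∂(P m) := by
      rw [integral_sub hm (integrable_const _)]; simp
    rw [Real.norm_eq_abs, abs_sub_comm, this]
    exact abs_integral_le_integral_abs
  refine h'.of_lt (tendstoZeroInProb_const hconst) fun ε hε => ⟨ε / 2, by linarith,
    Eventually.of_forall fun m ω h1 h2 => ?_⟩
  rw [abs_abs] at h1
  calc |Y m ω - ∫ ω', Y m ω' ∂(P m)|
      = |(Y m ω - c' m) + (c' m - ∫ ω', Y m ω' ∂(P m))| := by ring_nf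
    _ ≤ _ := abs_add_le _ _
    _ < ε := by linarith

end convergence

/-! ### Variance bound behind the law of large numbers -/

section LLN

variable {m : ℕ} {Ω : Type*} [MeasurableSpace Ω] {P : Measure Ω}
  {I₀ : Finset (Fin m)} {p : Fin m → Ω → ℝ} {lam : ℝ}

lemma BasicIndependence.integral_indLE (h : BasicIndependence P I₀ p) (hlam0 : 0 ≤ lam)
    (hlam1 : lam ≤ 1) {i : Fin m} (hi : i ∈ I₀) : ∫ ω, indLE lam (p i ω) ∂P = lam := by
  have hms : MeasurableSet {ω | p i ω ≤ lam} := measurableSet_le (h.measurable i) measurable_const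
  have : (fun ω => indLE lam (p i ω)) = {ω | p i ω ≤ lam}.indicator 1 := by
    funext ω; simp [indLE, Set.indicator]
  rw [this, integral_indicator_one hms, Measure.real, h.uniform_null i hi lam ⟨hlam0, hlam1⟩,
    ENNReal.toReal_ofReal hlam0]

variable [IsProbabilityMeasure P]

/-- Variances of independent indicators add, each is at most `1`, and there are at most `m` of them;
only the order `m` matters. -/
lemma BasicIndependence.integral_nullCnt_sub_sq_le (h : BasicIndependence P I₀ p)
    (hlam0 : 0 ≤ lam) (hlam1 : lam ≤ 1) :
    ∫ ω, (nullCnt lam I₀ (fun j => p j ω) - lam * I₀.card) ^ 2 ∂P ≤ m := by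
  set X : Fin m → Ω → ℝ := fun i ω => indLE lam (p i ω) with hX
  have hXm : ∀ i, Measurable (X i) := fun i => measurable_indLE measurable_const (h.measurable i)
  have hmem : ∀ i, MemLp (X i) 2 P := fun i =>
    MemLp.of_bound (hXm i).aestronglyMeasurable 1 (ae_of_all _ fun ω => abs_indLE_le_one _ _)
  have hpair : Set.Pairwise (I₀ : Set (Fin m)) fun i j => IndepFun (X i) (X j) P := by
    intro i hi j hj hij
    have := h.indep_null.indepFun (i := ⟨i, hi⟩) (j := ⟨j, hj⟩) (by simpa using hij)
    exact this.comp (φ := fun u => indLE lam u) (ψ := fun u => indLE lam u)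
      (measurable_indLE measurable_const measurable_id)
      (measurable_indLE measurable_const measurable_id)
  have hvar := IndepFun.variance_sum (fun i _ => hmem i) hpair
  have hsum : ∀ ω, (∑ i ∈ I₀, X i) ω = nullCnt lam I₀ fun j => p j ω := by
    intro ω; simp [nullCnt, hX]
  have hmean : ∫ ω, nullCnt lam I₀ (fun j => p j ω) ∂P = lam * I₀.card := by
    unfold nullCnt
    rw [integral_finsetSum _ fun i _ => (hmem i).integrable (by norm_num),
      Finset.sum_congr rfl fun i hi => h.integral_indLE hlam0 hlam1 hi]
    simp [mul_comm]
  have hsm : Measurable (∑ i ∈ I₀, X i) := by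
    have : (∑ i ∈ I₀, X i) = fun ω => nullCnt lam I₀ fun j => p j ω := funext hsum
    rw [this]
    exact measurable_nullCnt.comp h.measurable_vec
  rw [variance_eq_integral hsm.aemeasurable] at hvar
  simp only [hsum, hmean] at hvar
  rw [hvar]
  calc ∑ i ∈ I₀, variance (X i) P ≤ ∑ i ∈ I₀, (1 : ℝ) := by
        refine Finset.sum_le_sum fun i _ => ?_
        have := variance_le_sq_of_bounded (a := 0) (b := 1) (X := X i) (μ := P)
          (ae_of_all _ fun ω => ⟨indLE_nonneg _ _, indLE_le_one _ _⟩) (hXm i).aemeasurable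
        norm_num at this
        linarith
    _ = I₀.card := by simp
    _ ≤ m := by exact_mod_cast (Finset.card_le_univ I₀).trans (by simp)

end LLN

/-! ### Asymptotics -/

section asymptotics

variable {Ω : ℕ → Type*} [∀ m, MeasurableSpace (Ω m)] {P : ∀ m, Measure (Ω m)}
  [∀ m, IsProbabilityMeasure (P m)] {I₀ : ∀ m, Finset (Fin m)} {p : ∀ m, Fin m → Ω m → ℝ}
  {α lam : ℝ} {g : ∀ _ : ℕ, (Set.Ici lam → ℝ) → ℝ}

/-- Law of large numbers for the fraction of true nulls below `lam`. -/
lemma tendstoZeroInProb_nullCnt (hBI : ∀ m, BasicIndependence (P m) (I₀ m) (p m))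
    (hlam0 : 0 ≤ lam) (hlam1 : lam ≤ 1) {κ₀ : ℝ}
    (hA1 : Tendsto (fun m : ℕ => ((I₀ m).card : ℝ) / m) atTop (𝓝 κ₀)) :
    TendstoZeroInProb P fun m ω => nullCnt lam (I₀ m) (fun j => p m j ω) / m - lam * κ₀ := by
  have hb : ∀ m ω, |nullCnt lam (I₀ m) (fun j => p m j ω)| ≤ m := by
    intro m ω
    rw [abs_of_nonneg (nullCnt_nonneg _ _ _)]
    exact (nullCnt_le_cnt _ _ _).trans (by exact_mod_cast cnt_le _ _)
  have hcard : ∀ m, ((I₀ m).card : ℝ) ≤ m := fun m => by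
    exact_mod_cast (Finset.card_le_univ (I₀ m)).trans (by simp)
  have h1 : TendstoZeroInProb P fun m ω =>
      nullCnt lam (I₀ m) (fun j => p m j ω) / m - lam * ((I₀ m).card / m) := by
    rw [← TendstoZeroInProb.sq_iff]
    refine TendstoZeroInProb.of_tendsto_integral (Eventually.of_forall fun m => ?_)
      (Eventually.of_forall fun m ω => sq_nonneg _) ?_
    · refine (hBI m).integrable_of_bound
        (f := fun x => (nullCnt lam (I₀ m) x / m - lam * ((I₀ m).card / m)) ^ 2)
        (((measurable_nullCnt.div_const _).sub_const _).pow_const 2) (C := 2 ^ 2) fun ω => ?_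
      rw [abs_pow]
      refine pow_le_pow_left₀ (abs_nonneg _) ?_ 2
      refine (abs_sub _ _).trans ?_
      have e1 : |nullCnt lam (I₀ m) (fun j => p m j ω) / m| ≤ 1 := by
        rw [abs_div, Nat.abs_cast]
        exact div_le_one_of_le₀ (hb m ω) (by positivity)
      have e2 : |lam * ((I₀ m).card / m : ℝ)| ≤ 1 := by
        refine abs_mul_le_one (abs_le.2 ⟨by linarith, hlam1⟩) ?_
        rw [abs_of_nonneg (by positivity)]
        exact div_le_one_of_le₀ (hcard m) (by positivity)
      linarith
    · refine tendsto_of_tendsto_of_tendsto_of_le_of_le' tendsto_const_nhds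
        tendsto_one_div_atTop_nhds_zero_nat
        (Eventually.of_forall fun m => integral_nonneg fun ω => sq_nonneg _) ?_
      filter_upwards [eventually_ge_atTop 1] with m hm
      have hm0 : (0 : ℝ) < m := by exact_mod_cast hm
      have e : ∀ ω, (nullCnt lam (I₀ m) (fun j => p m j ω) / m - lam * ((I₀ m).card / m)) ^ 2 =
          ((m : ℝ) ^ 2)⁻¹ * (nullCnt lam (I₀ m) (fun j => p m j ω) - lam * (I₀ m).card) ^ 2 := by
        intro ω; field_simp
      simp only [e]
      rw [integral_const_mul]
      have := (hBI m).integral_nullCnt_sub_sq_le hlam0 hlam1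
      calc _ ≤ ((m : ℝ) ^ 2)⁻¹ * m := by gcongr
        _ = 1 / m := by field_simp
  have h2 : Tendsto (fun m : ℕ => lam * ((I₀ m).card / m : ℝ) - lam * κ₀) atTop (𝓝 0) := by
    have := (hA1.const_mul lam).sub_const (lam * κ₀)
    simpa using this
  refine h1.of_lt (tendstoZeroInProb_const h2) fun ε hε => ⟨ε / 2, by linarith,
    Eventually.of_forall fun m ω h3 h4 => ?_⟩
  calc _ = |(nullCnt lam (I₀ m) (fun j => p m j ω) / m - lam * ((I₀ m).card / m)) +
        (lam * ((I₀ m).card / m : ℝ) - lam * κ₀)| := by ring_nf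
    _ ≤ _ := abs_add_le _ _
    _ < ε := by linarith

/-- The correction term in the conditional variance is asymptotically negligible. -/
lemma tendsto_integral_nullCnt_mul_rate_sq (hBI : ∀ m, BasicIndependence (P m) (I₀ m) (p m))
    (hα : 0 < α) (hlam0 : 0 < lam) (hg : ∀ m, Measurable (g m))
    (hadm : ∀ m, 1 ≤ m → ∀ ω, Admissible α lam (g m) fun j => p m j ω) {w : ℝ} (hw : 0 < w)
    (hW : TendstoZeroInProb P fun m ω => nullCnt lam (I₀ m) (fun j => p m j ω) / m - w) :
    Tendsto (fun m => ∫ ω, nullCnt lam (I₀ m) (fun j => p m j ω) *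
      rate α lam (g m) (fun j => p m j ω) ^ 2 ∂(P m)) atTop (𝓝 0) := by
  have hb : ∀ m, 1 ≤ m → ∀ ω, 0 ≤ nullCnt lam (I₀ m) (fun j => p m j ω) *
      rate α lam (g m) (fun j => p m j ω) ^ 2 ∧ nullCnt lam (I₀ m) (fun j => p m j ω) *
      rate α lam (g m) (fun j => p m j ω) ^ 2 ≤ 1 := by
    intro m hm ω
    set x : Fin m → ℝ := fun j => p m j ω
    have hx : Admissible α lam (g m) x := hadm m hm ω
    have hr := hx.rate_pos hα hlam0
    refine ⟨mul_nonneg (nullCnt_nonneg _ _ _) (sq_nonneg _), ?_⟩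
    have e : nullCnt lam (I₀ m) x * rate α lam (g m) x ^ 2 =
        ∑ i ∈ I₀ m, indLE lam (x i) * rate α lam (g m) x ^ 2 := by
      rw [nullCnt, Finset.sum_mul]
    -- Wherever an indicator is nonzero the rate is at most `1`, so one factor `rate` can be dropped
    -- and the bound `condFDP ≤ 1` applies.
    have hle : ∑ i ∈ I₀ m, indLE lam (x i) * rate α lam (g m) x ^ 2 ≤
        ∑ i ∈ I₀ m, indLE lam (x i) * rate α lam (g m) x := by
      refine Finset.sum_le_sum fun i _ => ?_
      unfold indLE
      split_ifs with hi
      · have := hx.rate_le_one hα hlam0 hi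
        nlinarith
      · simp
    have hS := condFDP_le_one (I₀ := I₀ m) hx hα hlam0
    rw [condFDP, nullCnt, Finset.sum_mul] at hS
    linarith
  have hTZ : TendstoZeroInProb P fun m ω => nullCnt lam (I₀ m) (fun j => p m j ω) *
      rate α lam (g m) (fun j => p m j ω) ^ 2 := by
    refine hW.of_lt hW fun ε hε => ⟨w / 2, by positivity, ?_⟩
    have hlim : Tendsto (fun m : ℕ => (2 / w) * (1 / (m : ℝ))) atTop (𝓝 0) := by
      simpa using tendsto_one_div_atTop_nhds_zero_nat (𝕜 := ℝ) |>.const_mul (2 / w)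
    filter_upwards [(tendsto_order.1 hlim).2 ε hε, eventually_ge_atTop 1] with m hm hm1 ω h1 _
    set x : Fin m → ℝ := fun j => p m j ω
    have hx : Admissible α lam (g m) x := hadm m hm1 ω
    rw [abs_of_nonneg (hb m hm1 ω).1]
    refine lt_of_le_of_lt ?_ hm
    have hm0 : (0 : ℝ) < m := by exact_mod_cast hm1
    have hV : w / 2 * m < nullCnt lam (I₀ m) x := by
      have := (abs_lt.1 h1).1
      rw [← lt_div_iff₀ hm0]
      linarith
    have hVpos : 0 < nullCnt lam (I₀ m) x := lt_trans (by positivity) hV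
    have hS := condFDP_le_one (I₀ := I₀ m) hx hα hlam0
    have hS0 := condFDP_nonneg (I₀ := I₀ m) hx hα hlam0
    -- Rewritten this way the term is at most `1 / nullCnt`, hence of order `1 / m` where the law of
    -- large numbers is effective.
    have e : nullCnt lam (I₀ m) x * rate α lam (g m) x ^ 2 =
        condFDP α lam (g m) (I₀ m) x ^ 2 / nullCnt lam (I₀ m) x := by
      rw [condFDP]; field_simp
    rw [e]
    calc condFDP α lam (g m) (I₀ m) x ^ 2 / nullCnt lam (I₀ m) x ≤ 1 / (w / 2 * m) := by
          gcongr
          exact pow_le_one₀ hS0 hS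
      _ = 2 / w * (1 / m) := by field_simp
  refine hTZ.tendsto_integral (B := 1) ?_ ?_
  · filter_upwards [eventually_ge_atTop 1] with m hm
    refine (hBI m).integrable_of_bound
      (f := fun x => nullCnt lam (I₀ m) x * rate α lam (g m) x ^ 2)
      (measurable_nullCnt.mul ((measurable_rate (hg m)).pow_const 2)) (C := 1) fun ω => ?_
    have := hb m hm ω
    rw [abs_of_nonneg this.1]
    exact this.2
  · filter_upwards [eventually_ge_atTop 1] with m hm using hb m hm

lemma one_le_rejectionsOne {m : ℕ} {g : (Set.Ici lam → ℝ) → ℝ} {I₀ : Finset (Fin m)}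
    {x : Fin m → ℝ} (hx : Admissible α lam g x) (hα : 0 < α) (hlam0 : 0 ≤ lam)
    (hV : 0 < nullCnt lam I₀ x) : 1 ≤ rejectionsOne α lam g I₀ x := by
  rw [nullCnt_eq_card, Nat.cast_pos, Finset.card_pos] at hV
  rw [rejectionsOne, replaceOne, dif_pos hV]
  exact hx.one_le_rejections_update hα hlam0 (Finset.mem_filter.1 (Finset.min'_mem _ hV)).2

/-- The numerator lies in `[η, 1]` with high probability, so the quotient is small iff the
denominator is large; boundedness makes convergence in mean and in probability the same. -/
lemma tendsto_integral_condFDP_div_iff (hBI : ∀ m, BasicIndependence (P m) (I₀ m) (p m))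
    (hα : 0 < α) (hlam0 : 0 < lam) (hg : ∀ m, Measurable (g m))
    (hadm : ∀ m, 1 ≤ m → ∀ ω, Admissible α lam (g m) fun j => p m j ω) {w η : ℝ} (hw : 0 < w)
    (hη : 0 < η)
    (hW : TendstoZeroInProb P fun m ω => nullCnt lam (I₀ m) (fun j => p m j ω) / m - w)
    (hS : ∀ m, 1 ≤ m → ∀ ω, w / 2 < nullCnt lam (I₀ m) (fun j => p m j ω) / m →
      η ≤ condFDP α lam (g m) (I₀ m) fun j => p m j ω) :
    Tendsto (fun m => ∫ ω, condFDP α lam (g m) (I₀ m) (fun j => p m j ω) /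
        rejectionsOne α lam (g m) (I₀ m) (fun j => p m j ω) ∂(P m)) atTop (𝓝 0) ↔
      TendstoInftyInProb P fun m ω =>
        (rejectionsOne α lam (g m) (I₀ m) (fun j => p m j ω) : ℝ) := by
  have hint : ∀ᶠ m in atTop, Integrable (fun ω => condFDP α lam (g m) (I₀ m) (fun j => p m j ω) /
        rejectionsOne α lam (g m) (I₀ m) (fun j => p m j ω)) (P m) := by
    filter_upwards [eventually_ge_atTop 1] with m hm using
      (hBI m).integrable_condFDP_div hα hlam0 (hg m) (hadm m hm)
  have hb : ∀ m, 1 ≤ m → ∀ ω, 0 ≤ condFDP α lam (g m) (I₀ m) (fun j => p m j ω) /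
        rejectionsOne α lam (g m) (I₀ m) (fun j => p m j ω) ∧
      condFDP α lam (g m) (I₀ m) (fun j => p m j ω) /
        rejectionsOne α lam (g m) (I₀ m) (fun j => p m j ω) ≤ 1 := by
    intro m hm ω
    have h0 := condFDP_nonneg (I₀ := I₀ m) (hadm m hm ω) hα hlam0
    refine ⟨by positivity, ?_⟩
    rw [div_eq_mul_inv]
    exact mul_le_one₀ (condFDP_le_one (hadm m hm ω) hα hlam0) (by positivity)
      (inv_natCast_le_one _)
  have hev : ∀ᶠ m : ℕ in atTop, 1 ≤ m := eventually_ge_atTop 1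
  constructor
  · intro h C
    have hTZ := TendstoZeroInProb.of_tendsto_integral hint
      (by filter_upwards [hev] with m hm ω using (hb m hm ω).1) h
    -- On `rejectionsOne ≤ C` the quotient is at least `η / C`; the maximum with `1` covers small or
    -- negative `C`.
    have hC : 0 < η / max C 1 := by positivity
    have hsum := (hW (w / 2) (by positivity)).add (hTZ (η / max C 1) hC)
    rw [add_zero] at hsum
    refine tendsto_of_tendsto_of_tendsto_of_le_of_le' tendsto_const_nhds hsum
      (Eventually.of_forall fun _ => zero_le) ?_
    filter_upwards [hev] with m hm
    refine (measure_mono fun ω hω => ?_).trans (measure_union_le _ _)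
    by_contra hcon
    simp only [Set.mem_union, Set.mem_ofPred_eq, not_or, not_le] at hcon hω
    obtain ⟨h1, h2⟩ := hcon
    have hWw : w / 2 < nullCnt lam (I₀ m) (fun j => p m j ω) / m := by
      have := (abs_lt.1 h1).1
      linarith
    have hVpos : 0 < nullCnt lam (I₀ m) (fun j => p m j ω) := by
      by_contra hneg
      have h0 : nullCnt lam (I₀ m) (fun j => p m j ω) = 0 :=
        le_antisymm (not_lt.1 hneg) (nullCnt_nonneg _ _ _)
      rw [h0, zero_div] at hWw
      linarith
    have hR := one_le_rejectionsOne (hadm m hm ω) hα hlam0.le hVpos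
    have hR' : (0 : ℝ) < rejectionsOne α lam (g m) (I₀ m) (fun j => p m j ω) := by
      exact_mod_cast hR
    have hSη := hS m hm ω hWw
    rw [abs_of_nonneg (hb m hm ω).1] at h2
    refine absurd h2 (not_lt.2 ?_)
    gcongr
    · exact condFDP_nonneg (hadm m hm ω) hα hlam0
    · exact hω.trans (le_max_left _ _)
  · intro h
    have hTZ : TendstoZeroInProb P fun m ω => condFDP α lam (g m) (I₀ m) (fun j => p m j ω) /
        rejectionsOne α lam (g m) (I₀ m) (fun j => p m j ω) := by
      intro ε hε
      refine tendsto_of_tendsto_of_tendsto_of_le_of_le' tendsto_const_nhds (h ε⁻¹)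
        (Eventually.of_forall fun _ => zero_le) ?_
      filter_upwards [hev] with m hm
      refine measure_mono fun ω hω => ?_
      simp only [Set.mem_ofPred_eq] at hω ⊢
      rw [abs_of_nonneg (hb m hm ω).1] at hω
      have hS1 := condFDP_le_one (I₀ := I₀ m) (hadm m hm ω) hα hlam0
      -- A quotient of at least `ε` forces `rejectionsOne ≤ ε⁻¹`; this is trivial when the count is
      -- zero.
      rcases Nat.eq_zero_or_pos (rejectionsOne α lam (g m) (I₀ m) fun j => p m j ω) with h0 | h0
      · rw [h0]; simpa using hε.le
      · have hR' : (0 : ℝ) < rejectionsOne α lam (g m) (I₀ m) (fun j => p m j ω) := by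
          exact_mod_cast h0
        rw [le_div_iff₀ hR'] at hω
        rw [le_inv_comm₀ hR' hε, ← one_div, le_div_iff₀ hR']
        linarith
    exact hTZ.tendsto_integral (B := 1) hint (by filter_upwards [hev] with m hm using hb m hm)

end asymptotics

end

end MultipleTesting

/-! ### The equivalence -/

open MultipleTesting

theorem theorem4p2
    {Ω : ℕ → Type*} [∀ m, MeasurableSpace (Ω m)]
    (P : ∀ m, Measure (Ω m)) [∀ m, IsProbabilityMeasure (P m)]
    (I₀ : ∀ m, Finset (Fin m)) (p : ∀ m, Fin m → Ω m → ℝ)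
    (hBI : ∀ m, MultipleTesting.BasicIndependence (P m) (I₀ m) (p m))
    (α lam : ℝ) (hα : 0 < α) (hαlam : α ≤ lam) (hlam : lam < 1)
    -- the estimator of the number of true nulls is `g m` of the empirical distribution function
    -- restricted to `[lam, ∞)`
    (g : ∀ _ : ℕ, (Set.Ici lam → ℝ) → ℝ) (hg : ∀ m, Measurable (g m))
    (m0hat : ∀ m, Ω m → ℝ)
    (hm0hat : ∀ m ω, m0hat m ω = g m (MultipleTesting.ecdfTail lam (fun i => p m i ω)))
    -- (A1)
    (κ₀ : ℝ) (hκ₀ : 0 < κ₀)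
    (hA1 : Tendsto (fun m : ℕ => ((I₀ m).card : ℝ) / m) atTop (𝓝 κ₀))
    -- (A2)
    (hA2pos : ∀ m, 1 ≤ m → ∀ ω, 0 < m0hat m ω)
    (hA2 : ∀ m, 1 ≤ m → ∀ ω,
      MultipleTesting.countLE (fun i => p m i ω) lam ≤ lam / α * m0hat m ω)
    -- (A3)
    (K : ℝ) (hK : 0 < K) (hA3 : ∀ m : ℕ, 1 ≤ m → ∀ ω, m0hat m ω ≤ K * m) :
    MultipleTesting.TendstoZeroInProb P (fun m ω =>
        MultipleTesting.FDP α lam (g m) (I₀ m) (fun i => p m i ω)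
          - ∫ ω', MultipleTesting.FDP α lam (g m) (I₀ m) (fun i => p m i ω') ∂(P m))
    ↔
    (MultipleTesting.TendstoZeroInProb P (fun m ω =>
        m0hat m ω / m - ∫ ω', m0hat m ω' / m ∂(P m)) ∧
      MultipleTesting.TendstoInftyInProb P (fun m ω =>
        (MultipleTesting.rejectionsOne α lam (g m) (I₀ m) (fun i => p m i ω) : ℝ))) := by
  have hlam0 : 0 < lam := hα.trans_le hαlam
  have hev : ∀ᶠ m : ℕ in atTop, 1 ≤ m := eventually_ge_atTop 1
  have hadm : ∀ m, 1 ≤ m → ∀ ω, Admissible α lam (g m) fun j => p m j ω := by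
    intro m hm ω
    have hm0 : (m : ℝ) ≠ 0 := by positivity
    refine ⟨fun i => ((hBI m).mem_Icc i ω).1, hm0hat m ω ▸ hA2pos m hm ω, ?_⟩
    have h2 := hA2 m hm ω
    rw [hm0hat, countLE, ecdf, mul_div_cancel₀ _ hm0, div_mul_eq_mul_div, le_div_iff₀ hα] at h2
    exact h2
  have hw : 0 < lam * κ₀ := mul_pos hlam0 hκ₀
  have hW := tendstoZeroInProb_nullCnt hBI hlam0.le hlam.le hA1
  have hc : 0 < α / lam := div_pos hα hlam0
  -- The estimator cancels, and the product is governed by the law of large numbers alone.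
  have hmul : ∀ m, 1 ≤ m → ∀ ω, condFDP α lam (g m) (I₀ m) (fun j => p m j ω) * (m0hat m ω / m) =
      α / lam * (nullCnt lam (I₀ m) (fun j => p m j ω) / m) := by
    intro m hm ω
    have hm0 : (0 : ℝ) < m := by exact_mod_cast hm
    have := hA2pos m hm ω
    rw [hm0hat] at this ⊢
    rw [condFDP, rate]
    field_simp
  have hS1 : ∀ m, 1 ≤ m → ∀ ω, condFDP α lam (g m) (I₀ m) (fun j => p m j ω) ≤ 1 :=
    fun m hm ω => condFDP_le_one (hadm m hm ω) hα hlam0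
  have hS0 : ∀ m, 1 ≤ m → ∀ ω, 0 ≤ condFDP α lam (g m) (I₀ m) (fun j => p m j ω) :=
    fun m hm ω => condFDP_nonneg (hadm m hm ω) hα hlam0
  have hM0 : ∀ m, 1 ≤ m → ∀ ω, 0 < m0hat m ω / m := fun m hm ω =>
    div_pos (hA2pos m hm ω) (by exact_mod_cast hm)
  have hMK : ∀ m, 1 ≤ m → ∀ ω, m0hat m ω / m ≤ K := fun m hm ω =>
    (div_le_iff₀ (by exact_mod_cast hm)).2 (hA3 m hm ω)
  -- Lower bound for the estimator from `condFDP ≤ 1`, that is, from (A2).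
  have hMη : ∀ m, 1 ≤ m → ∀ ω, lam * κ₀ / 2 < nullCnt lam (I₀ m) (fun j => p m j ω) / m →
      α / lam * (lam * κ₀ / 2) ≤ m0hat m ω / m := by
    intro m hm ω hlt
    have h1 := hmul m hm ω
    have h2 := mul_lt_mul_of_pos_left hlt hc
    have h3 := mul_le_mul_of_nonneg_right (hS1 m hm ω) (hM0 m hm ω).le
    linarith
  -- Lower bound for `condFDP` from `m0hat / m ≤ K`, that is, from (A3).
  have hSη : ∀ m, 1 ≤ m → ∀ ω, lam * κ₀ / 2 < nullCnt lam (I₀ m) (fun j => p m j ω) / m →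
      α / lam * (lam * κ₀ / 2) / K ≤ condFDP α lam (g m) (I₀ m) fun j => p m j ω := by
    intro m hm ω hlt
    rw [div_le_iff₀ hK]
    have h1 := hmul m hm ω
    have h2 := mul_lt_mul_of_pos_left hlt hc
    have h3 := mul_le_mul_of_nonneg_left (hMK m hm ω) (hS0 m hm ω)
    linarith
  have hXm : ∀ m, Measurable fun x : Fin m → ℝ => FDP α lam (g m) (I₀ m) x :=
    fun m => measurable_FDP (hg m)
  have hSm : ∀ m, Measurable fun x : Fin m → ℝ => condFDP α lam (g m) (I₀ m) x :=
    fun m => measurable_condFDP (hg m)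
  set s : ℕ → ℝ := fun m => ∫ ω, condFDP α lam (g m) (I₀ m) (fun j => p m j ω) ∂(P m) with hs
  have hs1 : ∀ m, 1 ≤ m → 0 ≤ s m ∧ s m ≤ 1 := by
    intro m hm
    refine ⟨integral_nonneg (hS0 m hm), ?_⟩
    have := integral_mono ((hBI m).integrable_of_bound (hSm m) fun ω =>
      abs_condFDP_le_one (hadm m hm ω) hα hlam0) (integrable_const (1 : ℝ)) (hS1 m hm)
    simpa using this
  have hsX : ∀ m, 1 ≤ m → ∫ ω, FDP α lam (g m) (I₀ m) (fun j => p m j ω) ∂(P m) = s m :=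
    fun m hm => (hBI m).integral_FDP hα hlam0 hlam (hg m) (hadm m hm)
  have hbound : ∀ m, 1 ≤ m → ∀ y : ℝ, |y| ≤ 1 → |y - s m| ≤ 2 := by
    intro m hm y hy
    obtain ⟨h1, h2⟩ := hs1 m hm
    obtain ⟨h3, h4⟩ := abs_le.1 hy
    exact abs_le.2 ⟨by linarith, by linarith⟩
  have hsqb : ∀ m, 1 ≤ m → ∀ y : ℝ, |y| ≤ 1 → |(y - s m) ^ 2| ≤ 2 ^ 2 := by
    intro m hm y hy
    rw [abs_pow]
    exact pow_le_pow_left₀ (abs_nonneg _) (hbound m hm y hy) 2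
  have hFDP : TendstoZeroInProb P (fun m ω => FDP α lam (g m) (I₀ m) (fun i => p m i ω)
        - ∫ ω', FDP α lam (g m) (I₀ m) (fun i => p m i ω') ∂(P m)) ↔
      Tendsto (fun m => ∫ ω, (FDP α lam (g m) (I₀ m) (fun i => p m i ω) - s m) ^ 2 ∂(P m))
        atTop (𝓝 0) := by
    rw [tendstoZeroInProb_iff_integral_sq (B := 2)]
    · refine tendsto_congr' ?_
      filter_upwards [hev] with m hm
      rw [hsX m hm]
    · filter_upwards [hev] with m hm
      rw [hsX m hm]
      exact (hBI m).integrable_of_bound (((hXm m).sub_const _).pow_const 2) fun ω =>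
        hsqb m hm _ (abs_FDP_le_one (hadm m hm ω) hα)
    · filter_upwards [hev] with m hm ω
      rw [hsX m hm]
      exact hbound m hm _ (abs_FDP_le_one (hadm m hm ω) hα)
  have hcond : TendstoZeroInProb P (fun m ω => condFDP α lam (g m) (I₀ m) (fun i => p m i ω) - s m)
      ↔ Tendsto (fun m => ∫ ω, (condFDP α lam (g m) (I₀ m) (fun i => p m i ω) - s m) ^ 2 ∂(P m))
        atTop (𝓝 0) := by
    refine tendstoZeroInProb_iff_integral_sq (B := 2) ?_ ?_
    · filter_upwards [hev] with m hm
      exact (hBI m).integrable_of_bound (((hSm m).sub_const _).pow_const 2) fun ω =>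
        hsqb m hm _ (abs_condFDP_le_one (hadm m hm ω) hα hlam0)
    · filter_upwards [hev] with m hm ω
      exact hbound m hm _ (abs_condFDP_le_one (hadm m hm ω) hα hlam0)
  -- Both parts of the variance decomposition are nonnegative, so the sum vanishes asymptotically
  -- iff each part does.
  have hdecomp : Tendsto (fun m => ∫ ω, (FDP α lam (g m) (I₀ m) (fun i => p m i ω) - s m) ^ 2
        ∂(P m)) atTop (𝓝 0) ↔
      Tendsto (fun m => ∫ ω, (condFDP α lam (g m) (I₀ m) (fun i => p m i ω) - s m) ^ 2 ∂(P m))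
        atTop (𝓝 0) ∧
      Tendsto (fun m => ∫ ω, (FDP α lam (g m) (I₀ m) (fun i => p m i ω) -
        condFDP α lam (g m) (I₀ m) (fun i => p m i ω)) ^ 2 ∂(P m)) atTop (𝓝 0) := by
    have hnn : ∀ (m : ℕ) (f : Ω m → ℝ), 0 ≤ ∫ ω, f ω ^ 2 ∂(P m) := fun m f =>
      integral_nonneg fun ω => sq_nonneg _
    have heq : ∀ᶠ m in atTop, ∫ ω, (FDP α lam (g m) (I₀ m) (fun i => p m i ω) - s m) ^ 2 ∂(P m) =
        ∫ ω, (FDP α lam (g m) (I₀ m) (fun i => p m i ω) -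
          condFDP α lam (g m) (I₀ m) (fun i => p m i ω)) ^ 2 ∂(P m) +
        ∫ ω, (condFDP α lam (g m) (I₀ m) (fun i => p m i ω) - s m) ^ 2 ∂(P m) := by
      filter_upwards [hev] with m hm
      exact (hBI m).integral_FDP_sub_const_sq hα hlam0 hlam (hg m) (hadm m hm) (s m)
    constructor
    · intro h
      refine ⟨squeeze_zero' (Eventually.of_forall fun m => hnn m _) ?_ h,
        squeeze_zero' (Eventually.of_forall fun m => hnn m _) ?_ h⟩
      · filter_upwards [heq] with m hm
        rw [hm]
        exact le_add_of_nonneg_left (hnn m _)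
      · filter_upwards [heq] with m hm
        rw [hm]
        exact le_add_of_nonneg_right (hnn m _)
    · rintro ⟨h1, h2⟩
      rw [tendsto_congr' heq]
      simpa using h2.add h1
  have hcorr := tendsto_integral_nullCnt_mul_rate_sq hBI hα hlam0 hg hadm hw hW
  have hdiff : Tendsto (fun m => ∫ ω, (FDP α lam (g m) (I₀ m) (fun i => p m i ω) -
        condFDP α lam (g m) (I₀ m) (fun i => p m i ω)) ^ 2 ∂(P m)) atTop (𝓝 0) ↔
      Tendsto (fun m => ∫ ω, condFDP α lam (g m) (I₀ m) (fun j => p m j ω) /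
        rejectionsOne α lam (g m) (I₀ m) (fun j => p m j ω) ∂(P m)) atTop (𝓝 0) := by
    have heq : ∀ᶠ m in atTop, ∫ ω, (FDP α lam (g m) (I₀ m) (fun i => p m i ω) -
          condFDP α lam (g m) (I₀ m) (fun i => p m i ω)) ^ 2 ∂(P m) =
        ∫ ω, condFDP α lam (g m) (I₀ m) (fun j => p m j ω) /
          rejectionsOne α lam (g m) (I₀ m) (fun j => p m j ω) ∂(P m) -
        ∫ ω, nullCnt lam (I₀ m) (fun j => p m j ω) *
          rate α lam (g m) (fun j => p m j ω) ^ 2 ∂(P m) := by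
      filter_upwards [hev] with m hm
      exact (hBI m).integral_FDP_sub_condFDP_sq hα hlam0 hlam (hg m) (hadm m hm)
    rw [tendsto_congr' heq]
    constructor
    · intro h
      simpa using h.add hcorr
    · intro h
      simpa using h.sub hcorr
  have hinf := tendsto_integral_condFDP_div_iff hBI hα hlam0 hg hadm hw
    (div_pos (mul_pos hc (half_pos hw)) hK) hW hSη
  -- `of_mul_eq` is applied twice with the two factors in exchanged roles; `sub_integral` then turns
  -- the deterministic centre into the mean.
  have hest : TendstoZeroInProb P (fun m ω => condFDP α lam (g m) (I₀ m) (fun i => p m i ω) - s m)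
      ↔ TendstoZeroInProb P (fun m ω => m0hat m ω / m - ∫ ω', m0hat m ω' / m ∂(P m)) := by
    constructor
    · intro h
      refine (TendstoZeroInProb.of_mul_eq (B := fun m ω => m0hat m ω / m) hc hw
        (div_pos (mul_pos hc (half_pos hw)) hK) hW h
        (by filter_upwards [hev] with m hm using hmul m hm)
        (by filter_upwards [hev] with m hm using hSη m hm)).sub_integral (B := K) ?_ ?_
      · filter_upwards [hev] with m hm
        simp only [hm0hat] at hM0 hMK ⊢
        refine (hBI m).integrable_of_bound (f := fun x => g m (ecdfTail lam x) / m)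
          (((hg m).comp (measurable_ecdfTail lam)).div_const _) (C := K) fun ω => ?_
        rw [abs_of_pos (hM0 m hm ω)]
        exact hMK m hm ω
      · filter_upwards [hev] with m hm ω
        rw [abs_of_pos (hM0 m hm ω)]
        exact hMK m hm ω
    · intro h
      refine (TendstoZeroInProb.of_mul_eq (A := fun m ω => m0hat m ω / m)
        (B := fun m ω => condFDP α lam (g m) (I₀ m) (fun i => p m i ω)) hc hw
        (mul_pos hc (half_pos hw)) hW h
        (by filter_upwards [hev] with m hm ω using by rw [mul_comm]; exact hmul m hm ω)
        (by filter_upwards [hev] with m hm using hMη m hm)).sub_integral (B := 1) ?_ ?_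
      · filter_upwards [hev] with m hm
        exact (hBI m).integrable_of_bound (hSm m) fun ω =>
          abs_condFDP_le_one (hadm m hm ω) hα hlam0
      · filter_upwards [hev] with m hm ω
        exact abs_condFDP_le_one (hadm m hm ω) hα hlam0
  rw [hFDP, hdecomp, ← hcond, hdiff, hinf, hest]
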